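/- **Setting.** Let $\Gamma$ be a star-shaped network of lossless transmission lines with $m\ge 1$ infinite branches $e_1,\dots,e_m$ ($z\in[0,\infty)$) and $n\ge 0$ finite branches $e_{m+1},\dots,e_{m+n}$ ($z\in[0,l_j]$, $0<l_j<\infty$), all starting at the central node $z=0$, with inductance $L_j(z)$ and capacitance $C_j(z)$ per unit length. On each branch let $x(z)=\int_0^z\sqrt{L_jC_j}\,du$ be the Liouville (travelling time) coordinate, $\tau_j=x(l_j)$ the travelling time of the finite branch $e_j$ ($\tau_j=\infty$ for $j\le m$), $A_j=(C_j/L_j)^{1/4}$ and $V_j=A_j^{-1}\,d^2A_j/dx^2$ as functions of $x$. Assume: * A1: $L_j$, $C_j$ are twice differentiable; * A2: $L_j>0$, $C_j>0$; * A3: for $j\le m$, $L_j(z)$ and $C_j(z)$ have strictly positive finite limits as $z\to\infty$; * A4: $\int_0^{\tau_j}(1+x)|V_j(x)|\,dx<\infty$ for all $j$; * A5: $L_j(0)/C_j(0)$ does not depend on $j$. For real $k$, the reflection coefficient $R_1(k)$ is the number for which there are functions $y_j$ on the branches with $-y_j''+V_jy_j=k^2y_j$; $A_i^{-1}(0)y_i(0)=A_j^{-1}(0)y_j(0)$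 for all $i,j$; $\sum_jA_j(0)y_j'(0)=\sum_jA_j'(0)y_j(0)$; $y_j'(\tau_j)=\frac{A_j'(\tau_j)}{A_j(\tau_j)}y_j(\tau_j)$ for $j>m$; and, as $x\to\infty$, $y_1(x)=e^{-ikx}+R_1(k)e^{ikx}+o(1)$ and $y_j(x)=T_je^{ikx}+o(1)$ for some $T_j\in\mathbb C$, $2\le j\le m$. **Statement.** Under A1–A5, $R_1(k)$ exists and is unique for all large $k$, and: 1. As $k\to\infty$ away from the poles of the functions $\tan(k\tau_j)$, namely as $k\to\infty$ and $k\cos^2(k\tau_j)\to\infty$ for every $j=m+1,\dots,m+n$ (in particular as $k\to\infty$ with all $|\cos(k\tau_j)|\ge\delta$, for any fixed $\delta>0$), $$m=2\,\mathrm{Re}\Big(\frac1{1+R_1(k)}\Big)+o(1),\qquad \sum_{j=m+1}^{m+n}\tan(k\tau_j)=-2\,\mathrm{Im}\Big(\frac1{1+R_1(k)}\Big)+o(1).$$ 2. The high-frequency poles of $\mathrm{Im}\frac1{1+R_1}$ are those of the $\tan(k\tau_j)$: for every $\delta>0$, $\mathrm{Im}\frac{1}{1+R_1(k)}$ is bounded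 on the set of all sufficiently large $k$ with $|\cos(k\tau_j)|\ge\delta$ for all $j$; and for all $\eta,B>0$, for every sufficiently large $p$ with $\cos(p\tau_j)=0$ for some $j$, there is a $k$ with $|k-p|<\eta$ and $\big|\mathrm{Im}\frac1{1+R_1(k)}\big|>B$. 3. The high-frequency reflection coefficient determines $m$, and $\mathrm{Im}\frac1{1+R_1}$ determines the $\tau_j$ when these are distinct. Precisely, let $\Gamma'$ be a second such network (with $m',n',\tau_j',R_1'$) satisfying A1–A5. For every $\ell>0$ there is $k^*$ such that, for every $a\ge k^*$: if $R_1=R_1'$ on $[a,a+\ell]$, then $m=m'$. If moreover the $\tau_j$ are pairwise distinct and the $\tau_j'$ are pairwise distinct, then for every $\ell>0$ there is $k^*$ such that, for every $a\ge k^*$: if $\mathrm{Im}\frac1{1+R_1}=\mathrm{Im}\frac1{1+R_1'}$ on $[a,a+\ell]$, then $n=n'$ and the $\tau_j$ agree with the $\tau'_j$ up to order. -/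

import Mathlib

open Set Filter Topology MeasureTheory

noncomputable section

/-- A star-shaped network of lossless transmission lines: `m` half-infinite branches (index
`Sum.inl`) and `n` branches of finite positive length (index `Sum.inr`), all parameterized by
their length from the central node `z = 0`. `L e` and `C e` are the inductance and the capacitance
per unit length of the branch `e`; only their values on the branch matter. -/
structure StarNetwork (m n : ℕ) where
  L : Fin m ⊕ Fin n → ℝ → ℝ
  C : Fin m ⊕ Fin n → ℝ → ℝ
  len : Fin n → ℝ
  len_pos : ∀ j, 0 < len j

/-- `f` is twice differentiable on `S` (one-sided derivatives at the end points). -/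
def TwiceDifferentiableOn {F : Type*} [NormedAddCommGroup F] [NormedSpace ℝ F]
    (f : ℝ → F) (S : Set ℝ) : Prop :=
  DifferentiableOn ℝ f S ∧ DifferentiableOn ℝ (derivWithin f S) S

namespace StarNetwork

variable {m n : ℕ} (N : StarNetwork m n)

/-- The range of the length coordinate `z` on a branch. -/
def branch : Fin m ⊕ Fin n → Set ℝ
  | Sum.inl _ => Ici 0
  | Sum.inr j => Icc 0 (N.len j)

/-- The Liouville coordinate `x(z) = ∫₀ᶻ √(L C)`: the travelling time from the central node to
the point `z`. -/
def travelTime (e : Fin m ⊕ Fin n) (z : ℝ) : ℝ :=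
  ∫ u in (0 : ℝ)..z, Real.sqrt (N.L e u * N.C e u)

/-- The travelling time of the `j`-th finite branch. -/
def tau (j : Fin n) : ℝ := N.travelTime (Sum.inr j) (N.len j)

/-- The range of the Liouville coordinate `x` on a branch. -/
def liouvilleBranch : Fin m ⊕ Fin n → Set ℝ
  | Sum.inl _ => Ici 0
  | Sum.inr j => Icc 0 (N.tau j)

/-- The inverse `z(x)` of the Liouville transformation of a branch. -/
def position (e : Fin m ⊕ Fin n) : ℝ → ℝ :=
  Function.invFunOn (N.travelTime e) (N.branch e)

/-- `A(x) = (C / L)^{1/4}` in the Liouville coordinate. -/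
def amp (e : Fin m ⊕ Fin n) (x : ℝ) : ℝ :=
  (N.C e (N.position e x) / N.L e (N.position e x)) ^ (1 / 4 : ℝ)

/-- `A'(x)`. -/
def ampDeriv (e : Fin m ⊕ Fin n) : ℝ → ℝ :=
  derivWithin (N.amp e) (N.liouvilleBranch e)

/-- The potential `V = A⁻¹ A''`. -/
def potential (e : Fin m ⊕ Fin n) (x : ℝ) : ℝ :=
  (N.amp e x)⁻¹ * derivWithin (N.ampDeriv e) (N.liouvilleBranch e) x

/-- The assumptions A1 to A5 on the network. -/
structure Assumptions : Prop where
  /-- A1 -/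
  twiceDiff_L : ∀ e, TwiceDifferentiableOn (N.L e) (N.branch e)
  twiceDiff_C : ∀ e, TwiceDifferentiableOn (N.C e) (N.branch e)
  /-- A2 -/
  pos_L : ∀ e, ∀ z ∈ N.branch e, 0 < N.L e z
  pos_C : ∀ e, ∀ z ∈ N.branch e, 0 < N.C e z
  /-- A3 -/
  lim_L : ∀ i : Fin m, ∃ a : ℝ, 0 < a ∧ Tendsto (N.L (Sum.inl i)) atTop (𝓝 a)
  lim_C : ∀ i : Fin m, ∃ a : ℝ, 0 < a ∧ Tendsto (N.C (Sum.inl i)) atTop (𝓝 a)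
  /-- A4 -/
  decay : ∀ e, IntegrableOn (fun x => (1 + x) * |N.potential e x|) (N.liouvilleBranch e)
  /-- A5 -/
  node : ∀ e e', N.L e 0 / N.C e 0 = N.L e' 0 / N.C e' 0

/-- The derivative of a component of a wave function along its branch. -/
def waveDeriv (y : Fin m ⊕ Fin n → ℝ → ℂ) (e : Fin m ⊕ Fin n) : ℝ → ℂ :=
  derivWithin (y e) (N.liouvilleBranch e)

/-- `y` solves `-y'' + V y = k² y` on every branch. -/
def SolvesSchrodinger (k : ℝ) (y : Fin m ⊕ Fin n → ℝ → ℂ) : Prop :=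
  ∀ e, TwiceDifferentiableOn (y e) (N.liouvilleBranch e) ∧
    ∀ x ∈ N.liouvilleBranch e,
      -derivWithin (N.waveDeriv y e) (N.liouvilleBranch e) x + (N.potential e x : ℂ) * y e x
        = (k : ℂ) ^ 2 * y e x

/-- The Kirchhoff conditions at the central node: `A⁻¹ y` is continuous there and
`∑ A y' = ∑ A' y`. -/
def KirchhoffCondition (y : Fin m ⊕ Fin n → ℝ → ℂ) : Prop :=
  (∀ e e', ((N.amp e 0)⁻¹ : ℂ) * y e 0 = ((N.amp e' 0)⁻¹ : ℂ) * y e' 0) ∧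
    ∑ e, (N.amp e 0 : ℂ) * N.waveDeriv y e 0 = ∑ e, (N.ampDeriv e 0 : ℂ) * y e 0

/-- The condition `y' = (A' / A) y` (zero current) at the ends of the finite branches. -/
def EndCondition (y : Fin m ⊕ Fin n → ℝ → ℂ) : Prop :=
  ∀ j : Fin n, N.waveDeriv y (Sum.inr j) (N.tau j) =
    ((N.ampDeriv (Sum.inr j) (N.tau j) / N.amp (Sum.inr j) (N.tau j) : ℝ) : ℂ) *
      y (Sum.inr j) (N.tau j)

/-- `r` is the reflection coefficient at frequency `k` on the infinite branch of index `0`: there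
is a scattering solution which behaves like `e^{-ikx} + r e^{ikx}` at the end of that branch and
like `t e^{ikx}` at the end of every other infinite branch. -/
def IsReflectionCoeff [NeZero m] (k : ℝ) (r : ℂ) : Prop :=
  ∃ y : Fin m ⊕ Fin n → ℝ → ℂ,
    N.SolvesSchrodinger k y ∧ N.KirchhoffCondition y ∧ N.EndCondition y ∧
    Tendsto (fun x : ℝ => y (Sum.inl 0) x -
      (Complex.exp (-(Complex.I * k * x)) + r * Complex.exp (Complex.I * k * x)))
      atTop (𝓝 0) ∧
    ∀ i : Fin m, i ≠ 0 → ∃ t : ℂ,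
      Tendsto (fun x : ℝ => y (Sum.inl i) x - t * Complex.exp (Complex.I * k * x)) atTop (𝓝 0)

end StarNetwork

end

/-! At high frequency the potentials are negligible, so the network acts like a star of free
strings. On an infinite branch the outgoing solution has u'/u ≈ ik at the node. On a finite branch
the solution meeting the end condition is ≈ cos(k(x - τ)), with u'/u ≈ k tan(kτ). The Kirchhoff
condition is one linear equation for R; its leading part gives 1/(1+R) ≈ (m - i ∑ tan(kτ_j))/2,
whose real and imaginary parts are the two formulas.

Making this rigorous takes three ingredients. Solutions come from a Volterra equation, contracting
for k ≥ 2∫|V| (`IsAmplitude.exists_isWave`). Since V is only integrable, the equation y'' = (V -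
k²)y at every point, rather than almost every point, needs an argument: VA = A'' holds everywhere,
so integrals against V can be compared with increments of A' (`IsAmplitude.hasDerivWithinAt_tail`).
Existence and uniqueness of R rest on energy conservation (`outgoing_eq_zero`), which remains valid
at the Dirichlet eigenvalues of the finite branches. The error bound (`reflectionCoeff_asymptotics`)
is O(1/K) once k and all k cos²(kτ_j) are at least K.

The remaining claims concern sums of tangents, uniformly in the base frequency. The phases kτ_j
matter only modulo π and so lie in a compact cube; a property checked for every phase vector by one
shift s of the frequency therefore holds with a uniform margin ε (`exists_uniform_frequency_shift`).
Poles cannot cancel, because every tan tends to +∞ from the left of its pole. For the travelling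
times, equality of two tangent sums on an interval extends to the upper imaginary axis; there tan(θ
+ iστ) is i plus an exponential series in e^{-2τσ} with nonzero leading coefficient, and distinct
rates separate (`range_eq_of_tan_sum_eq`). Different sets of travelling times thus give sums
differing by a uniform margin somewhere in every window of length ℓ, which the asymptotics exclude
for equal data at high frequency. -/

noncomputable section

/-! ### The Volterra equation -/

/-- The Volterra equation at infinity with an integrable potential is solvable in bounded
continuous functions when the frequency is large. -/
theorem exists_volterra_solution {U : ℝ → ℝ} (hU : Integrable U) {k : ℝ} (hk : 0 < k)
    (hUk : 2 * ∫ t, |U t| ≤ k) (g : BoundedContinuousFunction ℝ ℂ) :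
    ∃ y : BoundedContinuousFunction ℝ ℂ, ‖y‖ ≤ 2 * ‖g‖ ∧
      ∀ x, y x = g x + (1 / k : ℝ) *
        ∫ t, ((Real.sin (k * max (t - x) 0) * U t : ℝ) : ℂ) * y t := by
  have hint : ∀ (y : BoundedContinuousFunction ℝ ℂ) (x : ℝ), Integrable
      (fun t => ((Real.sin (k * max (t - x) 0) * U t : ℝ) : ℂ) * y t) := by
    intro y x
    refine (((hU.bdd_mul (c := 1) ?_ ?_).ofReal).mul_bdd (c := ‖y‖) ?_ ?_)
    · exact (by fun_prop : Continuous fun t => Real.sin (k * max (t - x) 0)).aestronglyMeasurable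
    · exact Eventually.of_forall fun t => by
        simpa using Real.abs_sin_le_one _
    · exact y.continuous.aestronglyMeasurable
    · exact Eventually.of_forall fun t => y.norm_coe_le_norm t
  have hbd : ∀ (y : BoundedContinuousFunction ℝ ℂ) (x t : ℝ),
      ‖((Real.sin (k * max (t - x) 0) * U t : ℝ) : ℂ) * y t‖ ≤ |U t| * ‖y‖ := by
    intro y x t
    rw [norm_mul, Complex.norm_real, Real.norm_eq_abs, abs_mul]
    have h1 := Real.abs_sin_le_one (k * max (t - x) 0)
    have h2 := y.norm_coe_le_norm t
    have : |Real.sin (k * max (t - x) 0)| * |U t| ≤ |U t| := by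
      nlinarith [abs_nonneg (U t)]
    exact mul_le_mul this h2 (norm_nonneg _) (abs_nonneg _)
  have hI : ∀ (y : BoundedContinuousFunction ℝ ℂ) (x : ℝ),
      ‖((1 / k : ℝ) : ℂ) * ∫ t, ((Real.sin (k * max (t - x) 0) * U t : ℝ) : ℂ) * y t‖
        ≤ 1 / 2 * ‖y‖ := by
    intro y x
    have h1 : ‖∫ t, ((Real.sin (k * max (t - x) 0) * U t : ℝ) : ℂ) * y t‖
        ≤ ∫ t, |U t| * ‖y‖ :=
      norm_integral_le_of_norm_le (hU.abs.mul_const _) (Eventually.of_forall (hbd y x))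
    rw [integral_mul_const] at h1
    rw [norm_mul, Complex.norm_real, Real.norm_eq_abs, abs_of_pos (by positivity)]
    calc 1 / k * _ ≤ 1 / k * ((∫ t, |U t|) * ‖y‖) := by gcongr
      _ ≤ 1 / k * ((k / 2) * ‖y‖) := by gcongr; linarith
      _ = _ := by field_simp
  have hcont : ∀ y : BoundedContinuousFunction ℝ ℂ, Continuous
      (fun x => ((1 / k : ℝ) : ℂ) *
        ∫ t, ((Real.sin (k * max (t - x) 0) * U t : ℝ) : ℂ) * y t) := by
    intro y
    refine continuous_const.mul (continuous_of_dominated (fun x => (hint y x).1)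
      (fun x => Eventually.of_forall (hbd y x)) (hU.abs.mul_const _)
      (Eventually.of_forall fun t => by fun_prop))
  -- Banach's fixed point theorem in the sup norm. Since sin 0 = 0, the factor `max (t - x) 0`
  -- restricts the integral to t > x while keeping the kernel continuous in x.
  let T : BoundedContinuousFunction ℝ ℂ → BoundedContinuousFunction ℝ ℂ := fun y =>
    g + BoundedContinuousFunction.ofNormedAddCommGroup _ (hcont y) _ (hI y)
  have hT : ∀ y x, T y x = g x + ((1 / k : ℝ) : ℂ) *
      ∫ t, ((Real.sin (k * max (t - x) 0) * U t : ℝ) : ℂ) * y t := fun y x => rfl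
  have hc : ContractingWith (1 / 2) T := by
    refine ⟨by norm_num, LipschitzWith.of_dist_le_mul fun y z => ?_⟩
    rw [dist_eq_norm, dist_eq_norm]
    refine (BoundedContinuousFunction.norm_le (by positivity)).2 fun x => ?_
    have : (T y - T z) x = ((1 / k : ℝ) : ℂ) *
        ∫ t, ((Real.sin (k * max (t - x) 0) * U t : ℝ) : ℂ) * (y - z) t := by
      rw [BoundedContinuousFunction.sub_apply, hT, hT, add_sub_add_left_eq_sub, ← mul_sub,
        ← integral_sub (hint y x) (hint z x)]
      simp only [BoundedContinuousFunction.sub_apply, mul_sub]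
    rw [this]
    simpa using hI (y - z) x
  refine ⟨hc.fixedPoint, ?_, fun x => ?_⟩
  · have hfix : T hc.fixedPoint = hc.fixedPoint := hc.fixedPoint_isFixedPt
    have : ‖hc.fixedPoint‖ ≤ ‖g‖ + 1 / 2 * ‖hc.fixedPoint‖ := by
      conv_lhs => rw [← hfix]
      refine (norm_add_le _ _).trans (add_le_add le_rfl ?_)
      exact BoundedContinuousFunction.norm_ofNormedAddCommGroup_le _ (by positivity) _
    linarith
  · conv_lhs => rw [← show T hc.fixedPoint = hc.fixedPoint from hc.fixedPoint_isFixedPt]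
    rfl

theorem lipschitz_sin_mul_max {k : ℝ} (hk : 0 < k) (t a b : ℝ) :
    |Real.sin (k * max (t - a) 0) - Real.sin (k * max (t - b) 0)| ≤ k * |a - b| := by
  have h1 : ∀ u v : ℝ, |Real.sin u - Real.sin v| ≤ |u - v| := fun u v => by
    have := Real.lipschitzWith_sin.dist_le_mul u v
    simpa [Real.dist_eq] using this
  refine (h1 _ _).trans ?_
  rw [← mul_sub, abs_mul, abs_of_pos hk]
  refine mul_le_mul_of_nonneg_left ((abs_max_sub_max_le_abs (t - a) (t - b) 0).trans ?_) hk.le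
  rw [show t - a - (t - b) = b - a by ring, abs_sub_comm]

/-- Differentiation under the integral sign: the kernel is Lipschitz in x with constant k, and its
kink t = x is a null set. No regularity of U is needed for this first derivative. -/
theorem hasDerivAt_volterra_integral {U : ℝ → ℝ} (hU : Integrable U) {k : ℝ} (hk : 0 < k)
    (y : BoundedContinuousFunction ℝ ℂ) (x : ℝ) :
    HasDerivAt (fun x => ((1 / k : ℝ) : ℂ) *
        ∫ t, ((Real.sin (k * max (t - x) 0) * U t : ℝ) : ℂ) * y t)
      (-∫ t in Ioi x, ((Real.cos (k * (t - x)) * U t : ℝ) : ℂ) * y t) x := by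
  have hint : ∀ x : ℝ, Integrable
      (fun t => ((Real.sin (k * max (t - x) 0) * U t : ℝ) : ℂ) * y t) := by
    intro x
    refine (((hU.bdd_mul (c := 1) ?_ ?_).ofReal).mul_bdd (c := ‖y‖) ?_ ?_)
    · exact (by fun_prop : Continuous fun t => Real.sin (k * max (t - x) 0)).aestronglyMeasurable
    · exact Eventually.of_forall fun t => by
        simpa using Real.abs_sin_le_one _
    · exact y.continuous.aestronglyMeasurable
    · exact Eventually.of_forall fun t => y.norm_coe_le_norm t
  have key := hasDerivAt_integral_of_dominated_loc_of_lip (𝕜 := ℝ) (μ := volume) (s := univ)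
    (F := fun x t => ((Real.sin (k * max (t - x) 0) * U t : ℝ) : ℂ) * y t)
    (F' := (Ioi x).indicator fun t => -(k * ((Real.cos (k * (t - x)) * U t : ℝ) : ℂ) * y t))
    (bound := fun t => k * |U t| * ‖y‖) (x₀ := x) univ_mem
    (Eventually.of_forall fun x => (hint x).1) (hint x) ?_ ?_ ?_ ?_
  · have := key.2.const_mul ((1 / k : ℝ) : ℂ)
    refine this.congr_deriv ?_
    rw [integral_indicator measurableSet_Ioi, integral_neg, mul_neg, ← integral_const_mul]
    congr 2
    ext t
    have hk' : (k : ℂ) ≠ 0 := by exact_mod_cast hk.ne'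
    push_cast
    field_simp
  · refine AEStronglyMeasurable.indicator ?_ measurableSet_Ioi
    refine (AEStronglyMeasurable.mul (AEStronglyMeasurable.const_mul ?_ _)
      y.continuous.aestronglyMeasurable).neg
    refine Complex.continuous_ofReal.comp_aestronglyMeasurable ?_
    exact (by fun_prop : Continuous fun t => Real.cos (k * (t - x))).aestronglyMeasurable.mul hU.1
  · refine Eventually.of_forall fun t => LipschitzWith.lipschitzOnWith ?_
    refine LipschitzWith.of_dist_le_mul fun a b => ?_
    rw [dist_eq_norm, ← sub_mul, ← Complex.ofReal_sub, ← sub_mul, norm_mul, Complex.norm_real,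
      Real.norm_eq_abs, abs_mul, Real.coe_nnabs, Real.dist_eq,
      abs_of_nonneg (show 0 ≤ k * |U t| * ‖y‖ by positivity)]
    have h1 := lipschitz_sin_mul_max hk t a b
    have h2 := y.norm_coe_le_norm t
    calc _ ≤ k * |a - b| * |U t| * ‖y‖ := by gcongr
      _ = _ := by ring
  · exact (hU.abs.const_mul k).mul_const _
  · have hx : ∀ᵐ t : ℝ, t ≠ x := by
      simp [ae_iff, measure_singleton]
    filter_upwards [hx] with t ht
    rcases lt_or_gt_of_ne ht with h | h
    · rw [indicator_of_notMem (by simpa using h.le)]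
      refine (hasDerivAt_const x (0 : ℂ)).congr_of_eventuallyEq ?_
      filter_upwards [lt_mem_nhds h] with s hs
      rw [max_eq_right (by linarith)]
      simp
    · rw [indicator_of_mem (by simpa using h)]
      have h1 : HasDerivAt (fun s : ℝ => Real.sin (k * (t - s)) * U t)
          (-(k * Real.cos (k * (t - x)) * U t)) x := by
        have := (((hasDerivAt_id x).const_sub t).const_mul k).sin.mul_const (U t)
        refine this.congr_deriv ?_
        simp only [id]; ring
      have h2 := (h1.ofReal_comp).mul_const (y t)
      refine (h2.congr_of_eventuallyEq ?_).congr_deriv ?_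
      · filter_upwards [gt_mem_nhds h] with s hs
        rw [max_eq_left (by linarith)]
      · push_cast; ring

/-! ### Pointwise differentiation of integrals against a merely integrable potential -/

/-- `A` is a positive twice differentiable function on `S` with `A'' = V A`, where `V` is
integrable on `S`. -/
structure IsAmplitude (S : Set ℝ) (A A1 V : ℝ → ℝ) : Prop where
  deriv : ∀ x ∈ S, HasDerivWithinAt A (A1 x) S x
  deriv2 : ∀ x ∈ S, HasDerivWithinAt A1 (V x * A x) S x
  pos : ∀ x ∈ S, 0 < A x
  integrable : IntegrableOn V S

/-- `y'' = (V - k²) y` on `S`, with `y' = y1`. -/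
structure IsWave (V : ℝ → ℝ) (k : ℝ) (S : Set ℝ) (y y1 : ℝ → ℂ) : Prop where
  deriv : ∀ x ∈ S, HasDerivWithinAt y (y1 x) S x
  deriv2 : ∀ x ∈ S, HasDerivWithinAt y1 (((V x : ℂ) - (k : ℂ) ^ 2) * y x) S x

/-- The integral is at most C|x - x₀| times the mass of |U| between x₀ and x, and that mass tends to
0. Hence x₀ need not be a Lebesgue point of U. -/
theorem hasDerivWithinAt_integral_of_isBigO {S : Set ℝ} {U : ℝ → ℝ} (hU : Integrable U)
    {r : ℝ → ℂ} {x₀ C : ℝ} (hS : S.OrdConnected) (hx₀ : x₀ ∈ S)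
    (hr : ∀ᶠ t in 𝓝[S] x₀, ‖r t‖ ≤ C * |t - x₀|) :
    HasDerivWithinAt (fun x => ∫ t in x₀..x, (U t : ℂ) * r t) 0 S x₀ := by
  have hC : ∃ C, 0 ≤ C ∧ ∀ᶠ t in 𝓝[S] x₀, ‖r t‖ ≤ C * |t - x₀| :=
    ⟨max C 0, le_max_right _ _, hr.mono fun t ht => ht.trans
      (mul_le_mul_of_nonneg_right (le_max_left _ _) (abs_nonneg _))⟩
  clear hr
  obtain ⟨C, hC0, hr⟩ := hC
  obtain ⟨δ, hδ, hball⟩ := Metric.mem_nhdsWithin_iff.1 hr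
  rw [hasDerivWithinAt_iff_isLittleO]
  have h0 : Tendsto (fun x => ∫ t in x₀..x, |U t|) (𝓝[S] x₀) (𝓝 0) := by
    have := (intervalIntegral.continuous_primitive (μ := volume) (f := fun t => |U t|)
      (fun a b => hU.abs.intervalIntegrable) x₀).tendsto x₀
    rw [intervalIntegral.integral_same] at this
    exact this.mono_left nhdsWithin_le_nhds
  have h1 : (fun x => (x - x₀) * (C * ∫ t in x₀..x, |U t|)) =o[𝓝[S] x₀] fun x => x - x₀ := by
    have : (fun x => C * ∫ t in x₀..x, |U t|) =o[𝓝[S] x₀] fun _ => (1 : ℝ) := by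
      rw [Asymptotics.isLittleO_one_iff]
      simpa using h0.const_mul C
    simpa using (Asymptotics.isBigO_refl (fun x => x - x₀) (𝓝[S] x₀)).mul_isLittleO this
  refine Asymptotics.IsBigO.trans_isLittleO (Asymptotics.IsBigO.of_bound 1 ?_) h1
  filter_upwards [self_mem_nhdsWithin, nhdsWithin_le_nhds (Metric.ball_mem_nhds x₀ hδ)]
    with x hxS hxb
  rw [intervalIntegral.integral_same, smul_zero, sub_zero, sub_zero, one_mul]
  have hbd : ‖∫ t in x₀..x, (U t : ℂ) * r t‖ ≤ |∫ t in x₀..x, |U t| * (C * |x - x₀|)| := by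
    refine intervalIntegral.norm_integral_le_abs_of_norm_le ?_
      (hU.abs.mul_const _).intervalIntegrable
    filter_upwards [ae_restrict_mem measurableSet_uIoc] with t ht
    have ht' : t ∈ uIcc x₀ x := uIoc_subset_uIcc ht
    have hd : |t - x₀| ≤ |x - x₀| := abs_sub_left_of_mem_uIcc ht'
    have hmem : t ∈ Metric.ball x₀ δ ∩ S := by
      refine ⟨?_, hS.uIcc_subset hx₀ hxS ht'⟩
      rw [Metric.mem_ball, Real.dist_eq] at hxb ⊢
      exact hd.trans_lt hxb
    rw [norm_mul, Complex.norm_real, Real.norm_eq_abs]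
    have := hball hmem
    simp only [mem_ofPred_eq] at this
    gcongr
    exact this.trans (by gcongr)
  refine hbd.trans (le_of_eq ?_)
  rw [intervalIntegral.integral_mul_const, Real.norm_eq_abs, abs_mul, abs_mul, abs_mul, abs_mul,
    abs_abs]
  ring

theorem IsAmplitude.integrable_indicator {S : Set ℝ} (hm : MeasurableSet S) {A A1 V : ℝ → ℝ}
    (h : IsAmplitude S A A1 V) : Integrable (S.indicator V) :=
  (integrable_indicator_iff hm).2 h.integrable

/-- The fundamental theorem of calculus for an everywhere existing, integrable derivative: VA is the
derivative of A' at every point, although V may be discontinuous. -/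
theorem IsAmplitude.intervalIntegral_eq {S : Set ℝ} (hS : S.OrdConnected) (hm : MeasurableSet S)
    {A A1 V : ℝ → ℝ} (h : IsAmplitude S A A1 V) {a b : ℝ} (ha : a ∈ S) (hb : b ∈ S) :
    IntervalIntegrable (fun t => S.indicator V t * A t) volume a b ∧
      ∫ t in a..b, S.indicator V t * A t = A1 b - A1 a := by
  have hsub : uIcc a b ⊆ S := hS.uIcc_subset ha hb
  have hA : ContinuousOn A (uIcc a b) := fun x hx =>
    ((h.deriv x (hsub hx)).continuousWithinAt).mono hsub
  have hA1 : ContinuousOn A1 (uIcc a b) := fun x hx =>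
    ((h.deriv2 x (hsub hx)).continuousWithinAt).mono hsub
  have hI : IntervalIntegrable (fun t => S.indicator V t * A t) volume a b :=
    ((h.integrable_indicator hm).intervalIntegrable).mul_continuousOn hA
  refine ⟨hI, intervalIntegral.integral_eq_sub_of_hasDeriv_right hA1 (fun x hx => ?_) hI⟩
  have hx' : x ∈ S := hsub (Ioo_subset_Icc_self hx)
  have hnhds : S ∈ 𝓝 x := mem_of_superset (isOpen_Ioo.mem_nhds hx)
    (Ioo_subset_Icc_self.trans hsub)
  have := ((h.deriv2 x hx').hasDerivAt hnhds).hasDerivWithinAt (s := Ioi x)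
  rwa [indicator_of_mem hx']

/-- Near x₀ write H = bA + r with b = H(x₀)/A(x₀). The part bA integrates exactly to an increment of
bA', differentiable at x₀ with derivative V(x₀)H(x₀); the remainder r vanishes to first order at x₀
and contributes derivative 0. -/
theorem IsAmplitude.hasDerivWithinAt_tail {S : Set ℝ} (hS : S.OrdConnected)
    (hm : MeasurableSet S) {A A1 V : ℝ → ℝ} (h : IsAmplitude S A A1 V) {H : ℝ → ℂ}
    (hH : Continuous H) {C : ℝ} (hC : ∀ t, ‖H t‖ ≤ C) {x₀ : ℝ} (hx₀ : x₀ ∈ S) {H' : ℂ}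
    (hH' : HasDerivWithinAt H H' S x₀) :
    HasDerivWithinAt (fun x => ∫ t in Ioi x, ((S.indicator V t : ℝ) : ℂ) * H t)
      (-(V x₀ * H x₀)) S x₀ := by
  set U := S.indicator V with hUdef
  have hU : Integrable U := h.integrable_indicator hm
  have hUH : Integrable (fun t => (U t : ℂ) * H t) :=
    hU.ofReal.mul_bdd hH.aestronglyMeasurable (Eventually.of_forall hC)
  have hA0 : (A x₀ : ℂ) ≠ 0 := by exact_mod_cast (h.pos x₀ hx₀).ne'
  set b : ℂ := H x₀ / A x₀ with hb
  set r : ℝ → ℂ := fun t => H t - A t * b with hr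
  have hr0 : r x₀ = 0 := by
    simp only [hr, hb]; field_simp; ring
  have hrd : HasDerivWithinAt r (H' - A1 x₀ * b) S x₀ :=
    hH'.sub ((h.deriv x₀ hx₀).ofReal_comp.mul_const b)
  obtain ⟨c, hc⟩ := hrd.isBigO_sub.bound
  rw [prod_pure, eventually_map] at hc
  have hE := hasDerivWithinAt_integral_of_isBigO hU (C := c) hS hx₀ (hc.mono fun t ht => by
    simpa [hr0] using ht)
  have hmain : HasDerivWithinAt (fun x => (∫ t in Ioi x₀, (U t : ℂ) * H t)
      - (((A1 x - A1 x₀ : ℝ) : ℂ) * b + ∫ t in x₀..x, (U t : ℂ) * r t)) (-(V x₀ * H x₀)) S x₀ := by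
    have h1 := (((h.deriv2 x₀ hx₀).sub_const (A1 x₀)).ofReal_comp.mul_const b).add hE
    refine (h1.const_sub _).congr_deriv ?_
    rw [hb]; push_cast; field_simp; ring
  refine hmain.congr_of_mem (fun x hx => ?_) hx₀
  obtain ⟨hi, he⟩ := h.intervalIntegral_eq hS hm hx₀ hx
  have hi' : IntervalIntegrable (fun t => ((U t * A t : ℝ) : ℂ)) volume x₀ x :=
    ⟨hi.1.ofReal, hi.2.ofReal⟩
  have h2 := intervalIntegral.integral_interval_add_Ioi (hUH.integrableOn (s := Ioi x₀))
    (hUH.integrableOn (s := Ioi x))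
  have h3 : ∫ t in x₀..x, (U t : ℂ) * H t
      = ((A1 x - A1 x₀ : ℝ) : ℂ) * b + ∫ t in x₀..x, (U t : ℂ) * r t := by
    rw [← he, ← intervalIntegral.integral_ofReal, ← intervalIntegral.integral_mul_const,
      ← intervalIntegral.integral_add]
    · refine intervalIntegral.integral_congr fun t _ => ?_
      simp only [hr]; push_cast; ring
    · exact hi'.mul_const b
    · have e : (fun t => (U t : ℂ) * r t)
          = fun t => (U t : ℂ) * H t - ((U t * A t : ℝ) : ℂ) * b := by
        ext t; simp only [hr]; push_cast; ring
      rw [e]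
      exact hUH.intervalIntegrable.sub (hi'.mul_const b)
  rw [← h3, ← h2]; ring

/-! ### Waves with prescribed behaviour at the far end -/

/-- The mass of the potential beyond `x`. -/
def tailMass (V : ℝ → ℝ) (S : Set ℝ) (x : ℝ) : ℝ := ∫ t in Ioi x, |S.indicator V t|

theorem integral_abs_indicator {V : ℝ → ℝ} {S : Set ℝ} (hm : MeasurableSet S) :
    ∫ t, |S.indicator V t| = ∫ t in S, |V t| := by
  rw [← integral_indicator hm]
  congr 1
  ext t
  by_cases ht : t ∈ S <;> simp [ht]

theorem tailMass_le {V : ℝ → ℝ} {S : Set ℝ} (hm : MeasurableSet S) (hV : IntegrableOn V S)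
    (x : ℝ) : tailMass V S x ≤ ∫ t in S, |V t| := by
  rw [← integral_abs_indicator hm]
  exact setIntegral_le_integral ((integrable_indicator_iff hm).2 hV).abs
    (Eventually.of_forall fun _ => abs_nonneg _)

theorem tendsto_tailMass {V : ℝ → ℝ} {S : Set ℝ} (hm : MeasurableSet S) (hV : IntegrableOn V S) :
    Tendsto (tailMass V S) atTop (𝓝 0) := by
  have hU : Integrable (fun t => |S.indicator V t|) := ((integrable_indicator_iff hm).2 hV).abs
  have h1 := intervalIntegral_tendsto_integral_Ioi 0 hU.integrableOn tendsto_id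
  have h2 : tailMass V S = fun x => (∫ t in Ioi 0, |S.indicator V t|)
      - ∫ t in (0 : ℝ)..x, |S.indicator V t| := by
    ext x
    rw [← intervalIntegral.integral_interval_add_Ioi (hU.integrableOn (s := Ioi 0))
      (hU.integrableOn (s := Ioi x))]
    simp [tailMass]
  rw [h2]
  simpa using h1.const_sub (∫ t in Ioi 0, |S.indicator V t|)

theorem tailMass_eq_zero {V : ℝ → ℝ} {S : Set ℝ} {x : ℝ} (h : ∀ t ∈ S, t ≤ x) :
    tailMass V S x = 0 := by
  rw [tailMass, setIntegral_congr_fun (g := fun _ => (0 : ℝ)) measurableSet_Ioi]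
  · simp
  · intro t ht
    have : t ∉ S := fun hts => absurd (h t hts) (not_le.2 ht)
    simp [this]

/-- Solutions of the wave equation with prescribed free behaviour at the far end. -/
theorem IsAmplitude.exists_isWave {S : Set ℝ} (hS : S.OrdConnected)
    (hm : MeasurableSet S) {A A1 V : ℝ → ℝ} (h : IsAmplitude S A A1 V) {k : ℝ} (hk : 0 < k)
    (hVk : 2 * ∫ t in S, |V t| ≤ k) {g g1 : ℝ → ℂ} (hg : ∀ x, HasDerivAt g (g1 x) x)
    (hg1 : ∀ x, HasDerivAt g1 (-(k : ℂ) ^ 2 * g x) x) {B : ℝ} (hB : ∀ x, ‖g x‖ ≤ B) :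
    ∃ y y1 : ℝ → ℂ, IsWave V k S y y1 ∧
      (∀ x, ‖y x - g x‖ ≤ 2 * B / k * tailMass V S x) ∧
      ∀ x, ‖y1 x - g1 x‖ ≤ 2 * B * tailMass V S x := by
  set U := S.indicator V with hUdef
  have hU : Integrable U := h.integrable_indicator hm
  have hB0 : 0 ≤ B := (norm_nonneg _).trans (hB 0)
  have hk' : (k : ℂ) ≠ 0 := by exact_mod_cast hk.ne'
  have hgc : Continuous g := continuous_iff_continuousAt.2 fun x => (hg x).continuousAt
  obtain ⟨y, hyn, hy⟩ := exists_volterra_solution hU hk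
    (by rwa [hUdef, integral_abs_indicator hm])
    (BoundedContinuousFunction.ofNormedAddCommGroup g hgc B hB)
  have hyB : ∀ t, ‖y t‖ ≤ 2 * B := fun t => (y.norm_coe_le_norm t).trans (hyn.trans
    (mul_le_mul_of_nonneg_left
      (BoundedContinuousFunction.norm_ofNormedAddCommGroup_le _ hB0 _) zero_le_two))
  replace hy : ∀ x, y x = g x + (1 / k : ℝ) *
        ∫ t, ((Real.sin (k * max (t - x) 0) * U t : ℝ) : ℂ) * y t := hy
  set y1 : ℝ → ℂ := fun x =>
    g1 x + -∫ t in Ioi x, ((Real.cos (k * (t - x)) * U t : ℝ) : ℂ) * y t with hy1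
  have hyd : ∀ x, HasDerivAt y (y1 x) x := fun x =>
    ((hg x).add (hasDerivAt_volterra_integral hU hk y x)).congr_of_eventuallyEq
      (Eventually.of_forall fun x => hy x)
  have hUy : ∀ c : ℝ → ℝ, Continuous c → (∀ t, |c t| ≤ 1) →
      Integrable (fun t => (U t : ℂ) * ((c t : ℂ) * y t)) := by
    intro c hc hc1
    refine hU.ofReal.mul_bdd (c := 2 * B)
      ((Complex.continuous_ofReal.comp hc).mul y.continuous).aestronglyMeasurable
      (Eventually.of_forall fun t => ?_)
    rw [norm_mul, Complex.norm_real, Real.norm_eq_abs]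
    have := hyB t
    nlinarith [hc1 t, abs_nonneg (c t), norm_nonneg (y t)]
  refine ⟨y, y1, ⟨fun x _ => (hyd x).hasDerivWithinAt, fun x hx => ?_⟩, fun x => ?_, fun x => ?_⟩
  · have htail : ∀ c : ℝ → ℝ, Differentiable ℝ c → (∀ t, |c t| ≤ 1) →
        HasDerivWithinAt (fun x => ∫ t in Ioi x, (U t : ℂ) * ((c t : ℂ) * y t))
          (-(V x * ((c x : ℂ) * y x))) S x := by
      intro c hc hc1
      refine h.hasDerivWithinAt_tail hS hm (H := fun t => (c t : ℂ) * y t) (C := 2 * B)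
        (Complex.continuous_ofReal.comp hc.continuous |>.mul y.continuous) (fun t => ?_) hx
        (((hc x).hasDerivAt.ofReal_comp.mul (hyd x)).hasDerivWithinAt)
      rw [norm_mul, Complex.norm_real, Real.norm_eq_abs]
      have := hyB t
      nlinarith [hc1 t, abs_nonneg (c t), norm_nonneg (y t)]
    have hcd : Differentiable ℝ fun t : ℝ => Real.cos (k * t) := by fun_prop
    have hsd : Differentiable ℝ fun t : ℝ => Real.sin (k * t) := by fun_prop
    -- The addition formula moves x out of the integrands, leaving tail integrals to which `htail`
    -- applies.
    have hsplit : y1 = fun x => g1 x + -(((Real.cos (k * x) : ℝ) : ℂ) *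
          (∫ t in Ioi x, (U t : ℂ) * (((Real.cos (k * t) : ℝ) : ℂ) * y t)) +
        ((Real.sin (k * x) : ℝ) : ℂ) *
          ∫ t in Ioi x, (U t : ℂ) * (((Real.sin (k * t) : ℝ) : ℂ) * y t)) := by
      ext x
      rw [hy1, ← integral_const_mul, ← integral_const_mul, ← integral_add]
      · refine congrArg (fun z => g1 x + -z) ?_
        refine integral_congr_ae (Eventually.of_forall fun t => ?_)
        simp only
        rw [mul_sub, Real.cos_sub]
        push_cast
        ring
      · exact ((hUy _ hcd.continuous fun t => Real.abs_cos_le_one _).const_mul _).integrableOn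
      · exact ((hUy _ hsd.continuous fun t => Real.abs_sin_le_one _).const_mul _).integrableOn
    have hc := htail _ hcd fun t => Real.abs_cos_le_one _
    have hs := htail _ hsd fun t => Real.abs_sin_le_one _
    have hC : HasDerivAt (fun x : ℝ => Real.cos (k * x)) (-(k * Real.sin (k * x))) x := by
      refine (((hasDerivAt_id x).const_mul k).cos).congr_deriv ?_
      simp; ring
    have hD : HasDerivAt (fun x : ℝ => Real.sin (k * x)) (k * Real.cos (k * x)) x := by
      refine (((hasDerivAt_id x).const_mul k).sin).congr_deriv ?_
      simp; ring
    have h1 := (hC.ofReal_comp.hasDerivWithinAt (s := S)).mul hc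
    have h2 := (hD.ofReal_comp.hasDerivWithinAt (s := S)).mul hs
    have h3 := (hg1 x).hasDerivWithinAt (s := S) |>.add (h1.add h2).neg
    refine (h3.congr_of_mem (fun z _ => by rw [hsplit]; rfl) hx).congr_deriv ?_
    have hyx := hy x
    -- In y1', differentiating the outer cosine and sine gives -k times this integral, which is
    -- -k²(y - g); differentiating the tails gives Vy by cos² + sin² = 1. With g'' = -k²g the total
    -- is (V - k²)y.
    have e : (∫ t, ((Real.sin (k * max (t - x) 0) * U t : ℝ) : ℂ) * y t)
        = ((Real.cos (k * x) : ℝ) : ℂ) *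
            (∫ t in Ioi x, (U t : ℂ) * (((Real.sin (k * t) : ℝ) : ℂ) * y t)) -
          ((Real.sin (k * x) : ℝ) : ℂ) *
            ∫ t in Ioi x, (U t : ℂ) * (((Real.cos (k * t) : ℝ) : ℂ) * y t) := by
      rw [← integral_const_mul, ← integral_const_mul, ← integral_sub,
        ← integral_indicator measurableSet_Ioi]
      · refine integral_congr_ae (Eventually.of_forall fun t => ?_)
        by_cases ht : t ∈ Ioi x
        · simp only [indicator_of_mem ht]
          rw [max_eq_left (by have : x < t := ht; linarith), mul_sub, Real.sin_sub]
          push_cast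
          ring
        · simp only [indicator_of_notMem ht]
          rw [max_eq_right (by have : t ≤ x := not_lt.1 ht; linarith)]
          simp
      · exact ((hUy _ hsd.continuous fun t => Real.abs_sin_le_one _).const_mul _).integrableOn
      · exact ((hUy _ hcd.continuous fun t => Real.abs_cos_le_one _).const_mul _).integrableOn
    rw [e] at hyx
    set P := ∫ t in Ioi x, (U t : ℂ) * (((Real.sin (k * t) : ℝ) : ℂ) * y t)
    set Q := ∫ t in Ioi x, (U t : ℂ) * (((Real.cos (k * t) : ℝ) : ℂ) * y t)
    have hcs : ((Real.cos (k * x) : ℝ) : ℂ) ^ 2 + ((Real.sin (k * x) : ℝ) : ℂ) ^ 2 = 1 := by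
      exact_mod_cast Real.cos_sq_add_sin_sq (k * x)
    have hg' : g x = y x - (1 / k : ℝ) * (((Real.cos (k * x) : ℝ) : ℂ) * P
        - ((Real.sin (k * x) : ℝ) : ℂ) * Q) := by rw [hyx]; ring
    rw [hg']
    push_cast at hcs ⊢
    field_simp
    linear_combination (V x : ℂ) * y x * hcs
  · have h1 : y x - g x = ((1 / k : ℝ) : ℂ) *
        ∫ t, ((Real.sin (k * max (t - x) 0) * U t : ℝ) : ℂ) * y t := by rw [hy x]; ring
    have h2 : ‖∫ t, ((Real.sin (k * max (t - x) 0) * U t : ℝ) : ℂ) * y t‖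
        ≤ ∫ t, (Ioi x).indicator (fun t => |U t| * (2 * B)) t := by
      refine norm_integral_le_of_norm_le
        ((hU.abs.mul_const _).indicator measurableSet_Ioi) (Eventually.of_forall fun t => ?_)
      by_cases ht : t ∈ Ioi x
      · rw [indicator_of_mem ht, norm_mul, Complex.norm_real, Real.norm_eq_abs, abs_mul]
        have := hyB t
        have h3 := Real.abs_sin_le_one (k * max (t - x) 0)
        have : |Real.sin (k * max (t - x) 0)| * |U t| ≤ |U t| := by
          nlinarith [abs_nonneg (U t)]
        gcongr
      · rw [max_eq_right (by have : t ≤ x := not_lt.1 ht; linarith)]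
        simp [indicator_of_notMem ht]
    rw [integral_indicator measurableSet_Ioi, integral_mul_const] at h2
    rw [h1, norm_mul, Complex.norm_real, Real.norm_eq_abs, abs_of_pos (by positivity)]
    calc _ ≤ 1 / k * ((∫ t in Ioi x, |U t|) * (2 * B)) := by gcongr
      _ = _ := by rw [tailMass]; ring
  · have h1 : y1 x - g1 x = -∫ t in Ioi x, ((Real.cos (k * (t - x)) * U t : ℝ) : ℂ) * y t := by
      rw [hy1]; ring
    have h2 : ‖∫ t in Ioi x, ((Real.cos (k * (t - x)) * U t : ℝ) : ℂ) * y t‖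
        ≤ ∫ t in Ioi x, |U t| * (2 * B) := by
      refine norm_integral_le_of_norm_le (hU.abs.mul_const _).integrableOn
        (Eventually.of_forall fun t => ?_)
      rw [norm_mul, Complex.norm_real, Real.norm_eq_abs, abs_mul]
      have := hyB t
      have h3 := Real.abs_cos_le_one (k * (t - x))
      have : |Real.cos (k * (t - x))| * |U t| ≤ |U t| := by
        nlinarith [abs_nonneg (U t)]
      gcongr
    rw [integral_mul_const] at h2
    rw [h1, norm_neg]
    exact h2.trans (le_of_eq (by rw [tailMass]; ring))

/-! ### Wronskians, Jost solutions and solutions on a finite branch -/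

namespace IsWave

variable {V : ℝ → ℝ} {k : ℝ} {S : Set ℝ} {y y1 z z1 : ℝ → ℂ}

theorem sub (hy : IsWave V k S y y1) (hz : IsWave V k S z z1) :
    IsWave V k S (fun x => y x - z x) (fun x => y1 x - z1 x) :=
  ⟨fun x hx => (hy.deriv x hx).sub (hz.deriv x hx), fun x hx =>
    ((hy.deriv2 x hx).sub (hz.deriv2 x hx)).congr_deriv (by ring)⟩

theorem add (hy : IsWave V k S y y1) (hz : IsWave V k S z z1) :
    IsWave V k S (fun x => y x + z x) (fun x => y1 x + z1 x) :=
  ⟨fun x hx => (hy.deriv x hx).add (hz.deriv x hx), fun x hx =>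
    ((hy.deriv2 x hx).add (hz.deriv2 x hx)).congr_deriv (by ring)⟩

theorem const_mul (c : ℂ) (hy : IsWave V k S y y1) :
    IsWave V k S (fun x => c * y x) (fun x => c * y1 x) :=
  ⟨fun x hx => (hy.deriv x hx).const_mul c, fun x hx =>
    ((hy.deriv2 x hx).const_mul c).congr_deriv (by ring)⟩

theorem conj (hy : IsWave V k S y y1) :
    IsWave V k S (fun x => star (y x)) (fun x => star (y1 x)) :=
  ⟨fun x hx => (hy.deriv x hx).star, fun x hx =>
    ((hy.deriv2 x hx).star).congr_deriv (by simp)⟩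

theorem wronskian_eq (hS : S.OrdConnected) (hy : IsWave V k S y y1) (hz : IsWave V k S z z1)
    {a b : ℝ} (ha : a ∈ S) (hb : b ∈ S) :
    y a * z1 a - y1 a * z a = y b * z1 b - y1 b * z b := by
  have h := Convex.norm_image_sub_le_of_norm_hasDerivWithin_le (C := 0)
    (f := fun x => y x * z1 x - y1 x * z x) (f' := fun _ => 0) (s := S)
    (fun x hx => (((hy.deriv x hx).mul (hz.deriv2 x hx)).sub
      ((hy.deriv2 x hx).mul (hz.deriv x hx))).congr_deriv (by ring))
    (by simp) hS.convex hb ha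
  rw [zero_mul] at h
  exact sub_eq_zero.1 (norm_le_zero_iff.1 h)

end IsWave

/-- The Jost solution of a half line: `f` behaves like `e^{σ i k x}` at infinity. -/
structure IsJost (V : ℝ → ℝ) (k σ : ℝ) (f f1 : ℝ → ℂ) : Prop where
  wave : IsWave V k (Ici 0) f f1
  tendsto : Tendsto (fun x : ℝ => f x - Complex.exp (σ * (Complex.I * k * x))) atTop (𝓝 0)
  tendsto_deriv : Tendsto
    (fun x : ℝ => f1 x - σ * Complex.I * k * Complex.exp (σ * (Complex.I * k * x))) atTop (𝓝 0)

theorem norm_exp_wave (σ k x : ℝ) : ‖Complex.exp (σ * (Complex.I * k * x))‖ = 1 := by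
  rw [show (σ : ℂ) * (Complex.I * k * x) = ((σ * k * x : ℝ) : ℂ) * Complex.I by push_cast; ring]
  exact Complex.norm_exp_ofReal_mul_I _

theorem IsAmplitude.exists_isJost {A A1 V : ℝ → ℝ} (h : IsAmplitude (Ici 0) A A1 V) {k : ℝ}
    (hk : 0 < k) (hVk : 2 * ∫ t in Ici (0 : ℝ), |V t| ≤ k) {σ : ℝ} (hσ : σ ^ 2 = 1) :
    ∃ f f1 : ℝ → ℂ, IsJost V k σ f f1 ∧
      ‖f 0 - 1‖ ≤ 2 / k * ∫ t in Ici (0 : ℝ), |V t| ∧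
      ‖f1 0 - σ * Complex.I * k‖ ≤ 2 * ∫ t in Ici (0 : ℝ), |V t| := by
  have hσ' : (σ : ℂ) ^ 2 = 1 := by exact_mod_cast hσ
  have hexp : ∀ x : ℝ, HasDerivAt (fun x : ℝ => Complex.exp (σ * (Complex.I * k * x)))
      (σ * Complex.I * k * Complex.exp (σ * (Complex.I * k * x))) x := fun x => by
    have h0 : HasDerivAt (fun x : ℝ => (σ : ℂ) * (Complex.I * k * x)) (σ * (Complex.I * k)) x := by
      have := ((Complex.ofRealCLM.hasDerivAt (x := x)).const_mul (Complex.I * k)).const_mul (σ : ℂ)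
      simpa using this
    exact h0.cexp.congr_deriv (by ring)
  obtain ⟨f, f1, hf, h0, h1⟩ := h.exists_isWave ordConnected_Ici measurableSet_Ici hk hVk hexp
    (fun x => ((hexp x).const_mul (σ * Complex.I * k)).congr_deriv (by
      linear_combination (k : ℂ) ^ 2 * Complex.exp (σ * (Complex.I * k * x)) *
        ((σ : ℂ) ^ 2 * Complex.I_sq - hσ')))
    (B := 1) (fun x => (norm_exp_wave σ k x).le)
  have ht := tendsto_tailMass measurableSet_Ici h.integrable
  have hle := tailMass_le measurableSet_Ici h.integrable 0
  refine ⟨f, f1, ⟨hf, ?_, ?_⟩, ?_, ?_⟩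
  · exact squeeze_zero_norm h0 (by simpa only [mul_zero] using ht.const_mul (2 * 1 / k))
  · exact squeeze_zero_norm h1 (by simpa only [mul_zero] using ht.const_mul (2 * 1))
  · have := h0 0
    simp only [Complex.ofReal_zero, mul_zero, Complex.exp_zero, mul_one] at this
    exact this.trans (mul_le_mul_of_nonneg_left hle (by positivity))
  · have := h1 0
    simp only [Complex.ofReal_zero, mul_zero, Complex.exp_zero, mul_one] at this
    exact this.trans (mul_le_mul_of_nonneg_left hle (by positivity))

/-- Perturbation of the free solution cos(k(x - τ)) + (c/k) sin(k(x - τ)). No potential lies beyond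
τ, so the perturbation vanishes there and the data 1 and c at τ are attained exactly. -/
theorem IsAmplitude.exists_end_solution {A A1 V : ℝ → ℝ} {τ : ℝ}
    (h : IsAmplitude (Icc 0 τ) A A1 V) (c : ℝ) {k : ℝ}
    (hk : 0 < k) (hVk : 2 * ∫ t in Icc (0 : ℝ) τ, |V t| ≤ k) (hck : |c| ≤ k) :
    ∃ f f1 : ℝ → ℂ, IsWave V k (Icc 0 τ) f f1 ∧ f τ = 1 ∧ f1 τ = c ∧
      ‖f 0 - Real.cos (k * τ)‖ ≤ (|c| + 4 * ∫ t in Icc (0 : ℝ) τ, |V t|) / k ∧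
      ‖f1 0 - k * Real.sin (k * τ)‖ ≤ |c| + 4 * ∫ t in Icc (0 : ℝ) τ, |V t| := by
  have hk' : k ≠ 0 := hk.ne'
  have hC : ∀ x, HasDerivAt (fun x : ℝ => Real.cos (k * (x - τ)))
      (-(k * Real.sin (k * (x - τ)))) x := fun x => by
    refine ((((hasDerivAt_id x).sub_const τ).const_mul k).cos).congr_deriv ?_
    simp; ring
  have hD : ∀ x, HasDerivAt (fun x : ℝ => Real.sin (k * (x - τ)))
      (k * Real.cos (k * (x - τ))) x := fun x => by
    refine ((((hasDerivAt_id x).sub_const τ).const_mul k).sin).congr_deriv ?_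
    simp; ring
  have hg : ∀ x, HasDerivAt (fun x : ℝ => ((Real.cos (k * (x - τ))
      + c / k * Real.sin (k * (x - τ)) : ℝ) : ℂ))
      ((-(k * Real.sin (k * (x - τ))) + c * Real.cos (k * (x - τ)) : ℝ) : ℂ) x := fun x => by
    refine (((hC x).add ((hD x).const_mul (c / k))).congr_deriv ?_).ofReal_comp
    field_simp
  have hg1 : ∀ x, HasDerivAt (fun x : ℝ =>
      ((-(k * Real.sin (k * (x - τ))) + c * Real.cos (k * (x - τ)) : ℝ) : ℂ))
      (-(k : ℂ) ^ 2 * ((Real.cos (k * (x - τ)) + c / k * Real.sin (k * (x - τ)) : ℝ) : ℂ)) x :=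
    fun x => by
    refine ((((hD x).const_mul k).neg.add ((hC x).const_mul c))).ofReal_comp.congr_deriv ?_
    rw [← Complex.ofReal_pow, ← Complex.ofReal_neg, ← Complex.ofReal_mul]
    congr 1
    field_simp
    ring
  obtain ⟨f, f1, hf, h0, h1⟩ := h.exists_isWave ordConnected_Icc measurableSet_Icc hk hVk hg hg1
    -- The condition |c| ≤ k bounds the sine coefficient by 1; the factor 4 in the conclusion is 2B.
    (B := 2) (fun x => by
      rw [Complex.norm_real, Real.norm_eq_abs]
      refine (abs_add_le _ _).trans ?_
      rw [abs_mul, abs_div, abs_of_pos hk]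
      have e1 := Real.abs_cos_le_one (k * (x - τ))
      have e2 := Real.abs_sin_le_one (k * (x - τ))
      have e3 : |c| / k ≤ 1 := (div_le_one hk).2 hck
      have e4 : 0 ≤ |c| / k := by positivity
      nlinarith [abs_nonneg (Real.sin (k * (x - τ)))])
  have hle := tailMass_le measurableSet_Icc h.integrable 0
  have htail : tailMass V (Icc 0 τ) τ = 0 := tailMass_eq_zero fun t ht => ht.2
  have hs := Real.abs_sin_le_one (k * τ)
  have hcs := Real.abs_cos_le_one (k * τ)
  refine ⟨f, f1, hf, ?_, ?_, ?_, ?_⟩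
  · have := h0 τ
    rw [htail, mul_zero] at this
    simpa [sub_eq_zero] using norm_le_zero_iff.1 this
  · have := h1 τ
    rw [htail, mul_zero] at this
    simpa [sub_eq_zero] using norm_le_zero_iff.1 this
  · have h2 := (h0 0).trans (mul_le_mul_of_nonneg_left hle (by positivity))
    have h3 : f 0 - Real.cos (k * τ) = (f 0 - ((Real.cos (k * (0 - τ))
      + c / k * Real.sin (k * (0 - τ)) : ℝ) : ℂ)) + ((-(c / k * Real.sin (k * τ)) : ℝ) : ℂ) := by
      rw [zero_sub, mul_neg, Real.cos_neg, Real.sin_neg]; push_cast; ring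
    rw [h3]
    refine (norm_add_le _ _).trans ?_
    have h4 : ‖((-(c / k * Real.sin (k * τ)) : ℝ) : ℂ)‖ ≤ |c| / k := by
      rw [Complex.norm_real, Real.norm_eq_abs, abs_neg, abs_mul, abs_div, abs_of_pos hk]
      exact mul_le_of_le_one_right (by positivity) hs
    refine (add_le_add h2 h4).trans (le_of_eq ?_)
    field_simp
    ring
  · have h2 := (h1 0).trans (mul_le_mul_of_nonneg_left hle (by positivity))
    have h3 : f1 0 - k * Real.sin (k * τ) = (f1 0 - ((-(k * Real.sin (k * (0 - τ)))
      + c * Real.cos (k * (0 - τ)) : ℝ) : ℂ)) + ((c * Real.cos (k * τ) : ℝ) : ℂ) := by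
      rw [zero_sub, mul_neg, Real.cos_neg, Real.sin_neg]; push_cast; ring
    rw [h3]
    refine (norm_add_le _ _).trans ?_
    have h4 : ‖((c * Real.cos (k * τ) : ℝ) : ℂ)‖ ≤ |c| := by
      rw [Complex.norm_real, Real.norm_eq_abs, abs_mul]
      exact mul_le_of_le_one_right (by positivity) hcs
    linarith [add_le_add h2 h4]

namespace IsJost

variable {V : ℝ → ℝ} {k σ : ℝ} {f f1 g g1 y y1 : ℝ → ℂ}

theorem conj (hf : IsJost V k σ f f1) :
    IsJost V k (-σ) (fun x => star (f x)) (fun x => star (f1 x)) := by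
  have e : ∀ x : ℝ, Complex.exp (((-σ : ℝ) : ℂ) * (Complex.I * k * x))
      = star (Complex.exp ((σ : ℂ) * (Complex.I * k * x))) := fun x => by
    simp only [Complex.star_def, ← Complex.exp_conj]
    congr 1
    simp
  refine ⟨hf.wave.conj, ?_, ?_⟩
  · have := hf.tendsto.star
    simp only [star_zero] at this
    refine this.congr fun x => ?_
    rw [e, star_sub]
  · have := hf.tendsto_deriv.star
    simp only [star_zero] at this
    refine this.congr fun x => ?_
    rw [e, star_sub]
    simp

/-- The Wronskian is constant, and at infinity it tends to that of the free waves e^{σikx} and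
e^{-σikx}. -/
theorem wronskian (hf : IsJost V k σ f f1) (hg : IsJost V k (-σ) g g1) {x : ℝ} (hx : 0 ≤ x) :
    f x * g1 x - f1 x * g x = -2 * σ * Complex.I * k := by
  have hconst : ∀ z ∈ Ici (0 : ℝ), f z * g1 z - f1 z * g z = f x * g1 x - f1 x * g x :=
    fun z hz => hf.wave.wronskian_eq ordConnected_Ici hg.wave hz hx
  have hlim : Tendsto (fun z => f z * g1 z - f1 z * g z) atTop
      (𝓝 (-2 * σ * Complex.I * k)) := by
    have bdd : ∀ (s : ℝ) (c : ℂ) (u : ℝ → ℂ), Tendsto u atTop (𝓝 0) →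
        Tendsto (fun z : ℝ => u z * (c * Complex.exp (s * (Complex.I * k * z)))) atTop (𝓝 0) := by
      intro s c u hu
      refine hu.zero_mul_isBoundedUnder_le ?_
      refine isBoundedUnder_of ⟨‖c‖, fun z => ?_⟩
      simp only [Function.comp, norm_mul, norm_exp_wave, mul_one, le_refl]
    have e : ∀ z : ℝ, Complex.exp (σ * (Complex.I * k * z)) *
        Complex.exp (((-σ : ℝ) : ℂ) * (Complex.I * k * z)) = 1 := fun z => by
      rw [← Complex.exp_add]; simp
    have t1 := hf.tendsto.mul hg.tendsto_deriv
    have t2 := bdd (-σ) (((-σ : ℝ) : ℂ) * Complex.I * k) _ hf.tendsto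
    have t3 := bdd σ 1 _ hg.tendsto_deriv
    have t4 := hf.tendsto_deriv.mul hg.tendsto
    have t5 := bdd (-σ) 1 _ hf.tendsto_deriv
    have t6 := bdd σ (σ * Complex.I * k) _ hg.tendsto
    have t := (((((t1.add t2).add t3).sub t4).sub t5).sub t6).add_const (-2 * σ * Complex.I * k)
    simp only [mul_zero, add_zero, sub_zero, zero_add] at t
    refine t.congr fun z => ?_
    have := e z
    push_cast at this ⊢
    linear_combination (2 * (σ : ℂ) * Complex.I * k) * this
  have : (fun _ : ℝ => f x * g1 x - f1 x * g x) =ᶠ[atTop] fun z => f z * g1 z - f1 z * g z := by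
    filter_upwards [eventually_ge_atTop 0] with z hz using (hconst z hz).symm
  exact tendsto_nhds_unique (tendsto_const_nhds.congr' this) hlim

/-- Solutions which vanish at infinity are zero. -/
theorem eq_zero_of_tendsto (hk : 0 < k) (hf : IsJost V k 1 f f1) (hg : IsJost V k (-1) g g1)
    (hy : IsWave V k (Ici 0) y y1) (hlim : Tendsto y atTop (𝓝 0)) {x : ℝ} (hx : 0 ≤ x) :
    y x = 0 ∧ y1 x = 0 := by
  have hW : ∀ z, 0 ≤ z → f z * g1 z - f1 z * g z = -2 * Complex.I * k := fun z hz => by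
    simpa using hf.wronskian hg hz
  have hk' : (k : ℂ) ≠ 0 := by exact_mod_cast hk.ne'
  -- By Cramer's rule, a and -b are the coordinates of y in the basis f, g, up to the factor -2ik.
  set a := y x * g1 x - y1 x * g x with ha
  set b := y x * f1 x - y1 x * f x with hb
  have h2 : ∀ z, 0 ≤ z → a * f z - b * g z = -2 * Complex.I * k * y z := fun z hz => by
    have e1 := hy.wronskian_eq ordConnected_Ici hg.wave hx hz
    have e2 := hy.wronskian_eq ordConnected_Ici hf.wave hx hz
    rw [ha, hb, e1, e2, ← hW z hz]; ring
  have h3 : Tendsto (fun z : ℝ => a * Complex.exp (Complex.I * k * z)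
      - b * Complex.exp (-(Complex.I * k * z))) atTop (𝓝 0) := by
    have t1 := hf.tendsto.const_mul a
    have t2 := hg.tendsto.const_mul b
    have t3 := hlim.const_mul (-2 * Complex.I * k)
    have t := (t3.sub t1).add t2
    simp only [mul_zero, sub_zero, add_zero] at t
    refine t.congr' ?_
    filter_upwards [eventually_ge_atTop 0] with z hz
    rw [← h2 z hz]
    simp
    ring
  -- A shift by a quarter period π/(2k) multiplies the two exponentials by i and -i. Together with
  -- `h3` this separates them, so each tends to 0; having modulus 1, they force a = b = 0.
  have h4 : Tendsto (fun z : ℝ => Complex.I * (a * Complex.exp (Complex.I * k * z)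
      + b * Complex.exp (-(Complex.I * k * z)))) atTop (𝓝 0) := by
    refine (h3.comp (tendsto_atTop_add_const_right atTop (Real.pi / (2 * k)) tendsto_id)).congr
      fun z => ?_
    have e1 : Complex.I * k * ((z + Real.pi / (2 * k) : ℝ) : ℂ)
        = Complex.I * k * z + Real.pi / 2 * Complex.I := by
      push_cast; field_simp
    simp only [Function.comp, id]
    rw [e1, neg_add, Complex.exp_add, Complex.exp_add, Complex.exp_pi_div_two_mul_I,
      show -((Real.pi : ℂ) / 2 * Complex.I) = -Real.pi / 2 * Complex.I by ring,
      Complex.exp_neg_pi_div_two_mul_I]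
    ring
  have zero_of : ∀ (c : ℂ) (u : ℝ → ℂ), (∀ z, ‖u z‖ = 1) →
      Tendsto (fun z => c * u z) atTop (𝓝 0) → c = 0 := by
    intro c u hu h
    have := h.norm
    simp only [norm_mul, hu, mul_one, norm_zero] at this
    exact norm_eq_zero.1 (tendsto_nhds_unique tendsto_const_nhds this)
  have ha0 : a = 0 := by
    refine zero_of a (fun z => Complex.exp (Complex.I * k * z)) (fun z => ?_) ?_
    · simpa using norm_exp_wave 1 k z
    · have := (h3.sub (h4.const_mul Complex.I)).const_mul (1 / 2)
      simp only [mul_zero, sub_zero] at this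
      refine this.congr fun z => ?_
      linear_combination (-(1 / 2) * (a * Complex.exp (Complex.I * k * z)
        + b * Complex.exp (-(Complex.I * k * z)))) * Complex.I_sq
  have hb0 : b = 0 := by
    refine zero_of b (fun z => Complex.exp (-(Complex.I * k * z))) (fun z => ?_) ?_
    · simpa using norm_exp_wave (-1) k z
    · have := (h3.add (h4.const_mul Complex.I)).const_mul (-1 / 2)
      simp only [mul_zero, add_zero] at this
      refine this.congr fun z => ?_
      linear_combination (-(1 / 2) * (a * Complex.exp (Complex.I * k * z)
        + b * Complex.exp (-(Complex.I * k * z)))) * Complex.I_sq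
  have hne : -2 * Complex.I * (k : ℂ) ≠ 0 := by simp [hk']
  constructor
  · have := h2 x hx
    rw [ha0, hb0] at this
    simpa [hk'] using this.symm
  · have : y1 x * (-2 * Complex.I * k) = 0 := by
      rw [← hW x hx]
      linear_combination f1 x * ha0 - g1 x * hb0 - f1 x * ha + g1 x * hb
    exact (mul_eq_zero.1 this).resolve_right hne

end IsJost

/-! ### The Liouville transformation and the regularity of the amplitude -/

theorem exists_orderIso_of_pos {c : ℝ → ℝ} (hc : Continuous c) {a : ℝ} (ha : 0 < a)
    (hac : ∀ z, a ≤ c z) :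
    ∃ Ψ : ℝ ≃o ℝ, (∀ z, Ψ z = ∫ u in (0 : ℝ)..z, c u) ∧ (∀ z, HasDerivAt Ψ (c z) z) ∧
      ∀ x, HasDerivAt Ψ.symm (c (Ψ.symm x))⁻¹ x := by
  have hd : ∀ z, HasDerivAt (fun z => ∫ u in (0 : ℝ)..z, c u) (c z) z := fun z =>
    intervalIntegral.integral_hasDerivAt_right (hc.intervalIntegrable _ _)
      (hc.stronglyMeasurableAtFilter _ _) hc.continuousAt
  have hmono : StrictMono fun z => ∫ u in (0 : ℝ)..z, c u :=
    strictMono_of_hasDerivAt_pos hd fun z => ha.trans_le (hac z)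
  have hcont : Continuous fun z => ∫ u in (0 : ℝ)..z, c u :=
    continuous_iff_continuousAt.2 fun z => (hd z).continuousAt
  have hlin : Monotone fun z => (∫ u in (0 : ℝ)..z, c u) - a * z :=
    monotone_of_hasDerivAt_nonneg (f' := fun z => c z - a)
      (fun z => ((hd z).sub ((hasDerivAt_id z).const_mul a)).congr_deriv (by simp))
      fun z => sub_nonneg.2 (hac z)
  have htop : Tendsto (fun z => ∫ u in (0 : ℝ)..z, c u) atTop atTop := by
    refine tendsto_atTop_mono' _ ?_ (tendsto_id.const_mul_atTop ha)
    filter_upwards [eventually_ge_atTop 0] with z hz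
    have := hlin hz
    simp at this ⊢
    linarith
  have hbot : Tendsto (fun z => ∫ u in (0 : ℝ)..z, c u) atBot atBot := by
    refine tendsto_atBot_mono' _ ?_ (tendsto_id.const_mul_atBot ha)
    filter_upwards [eventually_le_atBot 0] with z hz
    have := hlin hz
    simp at this ⊢
    linarith
  let Ψ := hmono.orderIsoOfSurjective _ (hcont.surjective htop hbot)
  refine ⟨Ψ, fun z => rfl, hd, fun x => ?_⟩
  exact HasDerivAt.of_local_left_inverse Ψ.symm.continuous.continuousAt (hd (Ψ.symm x))
    (ha.trans_le (hac _)).ne' (Eventually.of_forall fun y => Ψ.apply_symm_apply y)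

theorem hasDerivWithinAt_rpow_quarter {S : Set ℝ} {L C : ℝ → ℝ} {L1 C1 z : ℝ}
    (hL : HasDerivWithinAt L L1 S z) (hC : HasDerivWithinAt C C1 S z) (hLz : 0 < L z)
    (hCz : 0 < C z) :
    HasDerivWithinAt (fun z => (C z / L z) ^ (1 / 4 : ℝ))
      ((C1 * L z - C z * L1) / L z ^ 2 * (1 / 4) * (C z / L z) ^ ((1 / 4 : ℝ) - 1)) S z :=
  (hC.div hL hLz.ne').rpow_const (Or.inl (div_pos hCz hLz).ne')

namespace StarNetwork

variable {m n : ℕ} (N : StarNetwork m n)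

theorem zero_mem_branch (e : Fin m ⊕ Fin n) : (0 : ℝ) ∈ N.branch e := by
  rcases e with i | j
  · exact self_mem_Ici
  · exact ⟨le_rfl, (N.len_pos j).le⟩

theorem exists_retraction_branch (e : Fin m ⊕ Fin n) :
    ∃ ρ : ℝ → ℝ, Continuous ρ ∧ (∀ z, ρ z ∈ N.branch e) ∧ ∀ z ∈ N.branch e, ρ z = z := by
  rcases e with i | j
  · exact ⟨fun z => max 0 z, by fun_prop, fun z => le_max_left 0 z,
      fun z hz => max_eq_right hz⟩
  · refine ⟨fun z => max 0 (min (N.len j) z), by fun_prop, fun z => ⟨le_max_left _ _,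
      max_le (N.len_pos j).le (min_le_left _ _)⟩, fun z hz => ?_⟩
    show max 0 (min (N.len j) z) = z
    rw [min_eq_right hz.2, max_eq_right hz.1]

theorem ordConnected_liouvilleBranch (e : Fin m ⊕ Fin n) : (N.liouvilleBranch e).OrdConnected := by
  rcases e with i | j
  · exact ordConnected_Ici
  · exact ordConnected_Icc

theorem measurableSet_liouvilleBranch (e : Fin m ⊕ Fin n) : MeasurableSet (N.liouvilleBranch e) := by
  rcases e with i | j
  · exact measurableSet_Ici
  · exact measurableSet_Icc

theorem liouvilleBranch_nonneg (e : Fin m ⊕ Fin n) {x : ℝ} (hx : x ∈ N.liouvilleBranch e) : 0 ≤ x := by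
  rcases e with i | j
  · exact hx
  · exact hx.1

variable {N}

namespace Assumptions

variable (hN : N.Assumptions) (e : Fin m ⊕ Fin n)
include hN

theorem continuousOn_slowness :
    ContinuousOn (fun u => Real.sqrt (N.L e u * N.C e u)) (N.branch e) :=
  ((hN.twiceDiff_L e).1.continuousOn.mul (hN.twiceDiff_C e).1.continuousOn).sqrt

theorem slowness_pos {z : ℝ} (hz : z ∈ N.branch e) : 0 < Real.sqrt (N.L e z * N.C e z) :=
  Real.sqrt_pos.2 (mul_pos (hN.pos_L e z hz) (hN.pos_C e z hz))

/-- Compactness on bounded pieces; on an infinite branch, A3 gives a positive limit, half of which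
bounds the slowness from below far out. This makes the Liouville coordinate run through all of [0,
∞). -/
theorem exists_le_slowness :
    ∃ a, 0 < a ∧ ∀ z ∈ N.branch e, a ≤ Real.sqrt (N.L e z * N.C e z) := by
  have hc := hN.continuousOn_slowness e
  have hcpt : ∀ b, Icc 0 b ⊆ N.branch e → 0 ≤ b →
      ∃ a, 0 < a ∧ ∀ z ∈ Icc 0 b, a ≤ Real.sqrt (N.L e z * N.C e z) := by
    intro b hb hb0
    obtain ⟨z, hz, hmin⟩ := isCompact_Icc.exists_isMinOn (nonempty_Icc.2 hb0) (hc.mono hb)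
    exact ⟨_, hN.slowness_pos e (hb hz), fun w hw => hmin hw⟩
  rcases e with i | j
  · obtain ⟨a, ha, hLa⟩ := hN.lim_L i
    obtain ⟨b, hb, hCb⟩ := hN.lim_C i
    have hlim : Tendsto (fun z => Real.sqrt (N.L (Sum.inl i) z * N.C (Sum.inl i) z)) atTop
        (𝓝 (Real.sqrt (a * b))) := (hLa.mul hCb).sqrt
    have hpos : 0 < Real.sqrt (a * b) := Real.sqrt_pos.2 (mul_pos ha hb)
    obtain ⟨z₀, hz₀⟩ := eventually_atTop.1 (hlim.eventually_const_le (half_lt_self hpos))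
    obtain ⟨d, hd, hd'⟩ := hcpt (max z₀ 0) Icc_subset_Ici_self (le_max_right _ _)
    refine ⟨min d (Real.sqrt (a * b) / 2), lt_min hd (by positivity), fun z hz => ?_⟩
    rcases le_total z (max z₀ 0) with h | h
    · exact (min_le_left _ _).trans (hd' z ⟨hz, h⟩)
    · exact (min_le_right _ _).trans (hz₀ z ((le_max_left _ _).trans h))
  · exact hcpt _ Subset.rfl (N.len_pos j).le

/-- Composing with a retraction onto the branch extends the slowness to the whole line, where the
Liouville map is a bijection. Its inverse then has two-sided derivatives even at the end points of
the branch. -/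
theorem exists_orderIso :
    ∃ Ψ : ℝ ≃o ℝ, Ψ 0 = 0 ∧ (∀ z ∈ N.branch e, Ψ z = N.travelTime e z) ∧
      ∀ x, Ψ.symm x ∈ N.branch e →
        HasDerivAt Ψ.symm (Real.sqrt (N.L e (Ψ.symm x) * N.C e (Ψ.symm x)))⁻¹ x := by
  obtain ⟨ρ, hρ, hρm, hρid⟩ := N.exists_retraction_branch e
  obtain ⟨a, ha, hac⟩ := hN.exists_le_slowness e
  obtain ⟨Ψ, h1, h2, h3⟩ := exists_orderIso_of_pos
    (c := fun z => Real.sqrt (N.L e (ρ z) * N.C e (ρ z)))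
    ((hN.continuousOn_slowness e).comp_continuous hρ hρm) ha fun z => hac _ (hρm z)
  refine ⟨Ψ, by simp [h1], fun z hz => ?_, fun x hx => ?_⟩
  · rw [h1, travelTime]
    refine intervalIntegral.integral_congr fun u hu => ?_
    have hu' : u ∈ N.branch e := by
      have hoc : (N.branch e).OrdConnected := by
        rcases e with i | j
        · exact ordConnected_Ici
        · exact ordConnected_Icc
      exact hoc.uIcc_subset (N.zero_mem_branch e) hz hu
    simp only [hρid u hu']
  · have := h3 x
    rwa [hρid _ hx] at this

theorem tau_pos (j : Fin n) : 0 < N.tau j := by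
  obtain ⟨Ψ, h0, h1, -⟩ := hN.exists_orderIso (Sum.inr j)
  rw [tau, ← h1 _ ⟨(N.len_pos j).le, le_rfl⟩, ← h0]
  exact Ψ.strictMono (N.len_pos j)

theorem uniqueDiffOn : UniqueDiffOn ℝ (N.liouvilleBranch e) := by
  rcases e with i | j
  · exact uniqueDiffOn_Ici 0
  · exact uniqueDiffOn_Icc (hN.tau_pos j)

theorem zero_mem : (0 : ℝ) ∈ N.liouvilleBranch e := by
  rcases e with i | j
  · exact self_mem_Ici
  · exact ⟨le_rfl, (hN.tau_pos j).le⟩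

/-- The inverse of the Liouville transformation is differentiable. -/
theorem exists_position : ∃ P : ℝ → ℝ, EqOn (N.position e) P (N.liouvilleBranch e) ∧
    MapsTo P (N.liouvilleBranch e) (N.branch e) ∧ P 0 = 0 ∧
    ∀ x ∈ N.liouvilleBranch e,
      HasDerivAt P (Real.sqrt (N.L e (P x) * N.C e (P x)))⁻¹ x := by
  obtain ⟨Ψ, h0, h1, h2⟩ := hN.exists_orderIso e
  have himg : ∀ x ∈ N.liouvilleBranch e, Ψ.symm x ∈ N.branch e := by
    intro x hx
    rcases e with i | j
    · have : Ψ.symm 0 ≤ Ψ.symm x := Ψ.symm.monotone hx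
      rwa [← h0, Ψ.symm_apply_apply] at this
    · refine ⟨?_, ?_⟩
      · have : Ψ.symm 0 ≤ Ψ.symm x := Ψ.symm.monotone hx.1
        rwa [← h0, Ψ.symm_apply_apply] at this
      · have : Ψ.symm x ≤ Ψ.symm (N.tau j) := Ψ.symm.monotone hx.2
        rwa [tau, ← h1 _ ⟨(N.len_pos j).le, le_rfl⟩, Ψ.symm_apply_apply] at this
  have hinj : InjOn (N.travelTime e) (N.branch e) := fun z hz w hw h => by
    rw [← h1 z hz, ← h1 w hw] at h
    exact Ψ.injective h
  refine ⟨Ψ.symm, fun x hx => ?_, himg, ?_, fun x hx => h2 x (himg x hx)⟩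
  · have hz := himg x hx
    have : x = N.travelTime e (Ψ.symm x) := by rw [← h1 _ hz, Ψ.apply_symm_apply]
    conv_lhs => rw [this]
    exact hinj.leftInvOn_invFunOn hz
  · rw [← h0, Ψ.symm_apply_apply, h0]

theorem amp_zero (e e' : Fin m ⊕ Fin n) : N.amp e 0 = N.amp e' 0 := by
  have hp : ∀ e, N.position e 0 = 0 := fun e => by
    obtain ⟨P, h1, -, h0, -⟩ := hN.exists_position e
    rw [h1 (hN.zero_mem e), h0]
  have h := congrArg (·⁻¹) (hN.node e e')
  simp only [inv_div] at h
  rw [amp, amp, hp, hp, h]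

theorem isAmplitude :
    IsAmplitude (N.liouvilleBranch e) (N.amp e) (N.ampDeriv e) (N.potential e) := by
  obtain ⟨P, hP, hPm, -, hPd⟩ := hN.exists_position e
  set J := N.liouvilleBranch e with hJ
  set B := N.branch e with hB
  have hu : UniqueDiffOn ℝ J := hN.uniqueDiffOn e
  have hLd := (hN.twiceDiff_L e).1
  have hCd := (hN.twiceDiff_C e).1
  set r : ℝ → ℝ := fun z => (derivWithin (N.C e) B z * N.L e z - N.C e z * derivWithin (N.L e) B z)
    / N.L e z ^ 2 * (1 / 4) * (N.C e z / N.L e z) ^ ((1 / 4 : ℝ) - 1)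
      -- The factor dz/dx of the chain rule; `r` is thus dA/dx expressed in the coordinate z.
      * (Real.sqrt (N.L e z * N.C e z))⁻¹ with hr
  have hA : ∀ x ∈ J, HasDerivWithinAt (N.amp e) (r (P x)) J x := by
    intro x hx
    have hz := hPm hx
    have h1 := hasDerivWithinAt_rpow_quarter (hLd _ hz).hasDerivWithinAt
      (hCd _ hz).hasDerivWithinAt (hN.pos_L e _ hz) (hN.pos_C e _ hz)
    have h2 := h1.comp x (hPd x hx).hasDerivWithinAt hPm
    exact h2.congr_of_mem (fun w hw => by simp only [amp, Function.comp, hP hw]) hx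
  have hA1 : EqOn (N.ampDeriv e) (fun x => r (P x)) J := fun x hx => (hA x hx).derivWithin (hu x hx)
  have hrd : DifferentiableOn ℝ r B := by
    have hCL : ∀ z ∈ B, N.C e z / N.L e z ≠ 0 := fun z hz =>
      (div_pos (hN.pos_C e z hz) (hN.pos_L e z hz)).ne'
    have hL0 : ∀ z ∈ B, N.L e z ≠ 0 := fun z hz => (hN.pos_L e z hz).ne'
    refine DifferentiableOn.mul (DifferentiableOn.mul (DifferentiableOn.mul_const
      (DifferentiableOn.div ?_ (hLd.pow 2) fun z hz => pow_ne_zero 2 (hL0 z hz)) _)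
      ((hCd.div hLd hL0).rpow_const fun z hz => Or.inl (hCL z hz))) (DifferentiableOn.inv
        ((hLd.mul hCd).sqrt fun z hz => ?_) fun z hz => (hN.slowness_pos e hz).ne')
    · exact ((hN.twiceDiff_C e).2.mul hLd).sub (hCd.mul (hN.twiceDiff_L e).2)
    · exact (mul_pos (hN.pos_L e z hz) (hN.pos_C e z hz)).ne'
  have hA1d : DifferentiableOn ℝ (N.ampDeriv e) J :=
    (hrd.comp (fun x hx => (hPd x hx).differentiableAt.differentiableWithinAt) hPm).congr hA1
  have hpos : ∀ x ∈ J, 0 < N.amp e x := fun x hx => by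
    rw [amp, hP hx]
    exact Real.rpow_pos_of_pos (div_pos (hN.pos_C e _ (hPm hx)) (hN.pos_L e _ (hPm hx))) _
  refine ⟨fun x hx => ?_, fun x hx => ?_, hpos, ?_⟩
  · rw [hA1 hx]; exact hA x hx
  · refine (hA1d x hx).hasDerivWithinAt.congr_deriv ?_
    have := (hpos x hx).ne'
    rw [potential, mul_comm, mul_inv_cancel_left₀ this]
  · have hmeas : MeasurableSet J := N.measurableSet_liouvilleBranch e
    -- In the interior the one-sided second derivative is an ordinary `deriv`, which is always
    -- measurable; the frontier of an interval is null.
    have hint : ∀ᵐ x ∂(volume.restrict J), x ∈ interior J := by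
      have h0 : volume (frontier J) = 0 :=
        (N.ordConnected_liouvilleBranch e).convex.addHaar_frontier volume
      have h1 : ∀ᵐ x ∂(volume.restrict J), x ∉ frontier J :=
        ae_restrict_of_ae (measure_eq_zero_iff_ae_notMem.1 h0)
      filter_upwards [h1, ae_restrict_mem hmeas] with x hx hxJ
      by_contra hni
      exact hx ⟨subset_closure hxJ, hni⟩
    have hsm : AEStronglyMeasurable (N.potential e) (volume.restrict J) := by
      have hAc : ContinuousOn (N.amp e) J := fun x hx => (hA x hx).continuousWithinAt
      have h1 : AEStronglyMeasurable (fun x => (N.amp e x)⁻¹ * deriv (N.ampDeriv e) x)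
          (volume.restrict J) :=
        ((hAc.inv₀ fun x hx => (hpos x hx).ne').aestronglyMeasurable hmeas).mul
          (measurable_deriv _).aestronglyMeasurable
      refine h1.congr ?_
      filter_upwards [hint] with x hx
      rw [potential, derivWithin_of_mem_nhds (mem_interior_iff_mem_nhds.1 hx)]
    -- Since x ≥ 0, A4 dominates |V|; only the integrability of V is used from here on.
    refine (hN.decay e).mono' hsm ?_
    filter_upwards [ae_restrict_mem hmeas] with x hx
    have := N.liouvilleBranch_nonneg e hx
    rw [Real.norm_eq_abs]
    nlinarith [abs_nonneg (N.potential e x)]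

end Assumptions

end StarNetwork

/-! ### Existence and uniqueness of the reflection coefficient -/

/-- The matching problem at the node: a and b are the values and slopes of the outgoing solutions, α
and β those of the incoming wave on e₀, w the common node value. If no a vanishes, eliminating c
leaves one scalar equation for w, solvable by `hG`. Otherwise w = 0 is forced, and a branch with a =
0 (a Dirichlet eigenvalue) balances the flux. -/
theorem exists_node_coefficients {E : Type*} [Fintype E] [DecidableEq E] (e₀ : E) (a b : E → ℂ)
    (α β D : ℂ) (h₀ : a e₀ ≠ 0) (hb : ∀ e, a e = 0 → b e ≠ 0)
    (hG : (∀ e, a e ≠ 0) → ∑ e, b e / a e ≠ D) :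
    ∃ (c : E → ℂ) (w : ℂ), (∀ e, c e * a e + (if e = e₀ then α else 0) = w) ∧
      ∑ e, (c e * b e + if e = e₀ then β else 0) = D * w := by
  by_cases h : ∀ e, a e ≠ 0
  · have hG' := sub_ne_zero.2 (hG h)
    set w := (α * b e₀ / a e₀ - β) / (∑ e, b e / a e - D) with hw
    refine ⟨fun e => (w - if e = e₀ then α else 0) / a e, w, fun e => ?_, ?_⟩
    · have := h e
      field_simp
      ring
    · have e1 : ∀ e, (w - if e = e₀ then α else 0) / a e * b e + (if e = e₀ then β else 0)
          = w * (b e / a e) + if e = e₀ then β - α * b e₀ / a e₀ else 0 := by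
        intro e
        by_cases he : e = e₀
        · subst he
          simp only [if_true]
          field_simp
          ring
        · simp only [if_neg he]
          field_simp [h e]
          ring
      simp only [e1, Finset.sum_add_distrib, ← Finset.mul_sum, Finset.sum_ite_eq',
        Finset.mem_univ, if_true]
      have e2 : w * (∑ e, b e / a e - D) = α * b e₀ / a e₀ - β := by
        rw [hw]; field_simp
      linear_combination e2
  · push Not at h
    obtain ⟨e₁, h₁⟩ := h
    have hne : e₁ ≠ e₀ := fun h => h₀ (h ▸ h₁)
    have hb₁ := hb e₁ h₁
    refine ⟨fun e => if e = e₀ then -α / a e₀ else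
      if e = e₁ then (α * b e₀ / a e₀ - β) / b e₁ else 0, 0, fun e => ?_, ?_⟩
    · by_cases he : e = e₀
      · subst he
        simp only [if_true]
        field_simp
        ring
      · by_cases he' : e = e₁
        · subst he'
          simp [he, h₁]
        · simp [he, he']
    · have e1 : ∀ e, (if e = e₀ then -α / a e₀ else
          if e = e₁ then (α * b e₀ / a e₀ - β) / b e₁ else 0) * b e + (if e = e₀ then β else 0)
          = (if e = e₀ then β - α * b e₀ / a e₀ else 0)
            + if e = e₁ then α * b e₀ / a e₀ - β else 0 := by
        intro e
        by_cases he : e = e₀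
        · subst he
          simp only [if_true, if_neg hne.symm]
          ring
        · by_cases he' : e = e₁
          · subst he'
            simp only [if_neg he, if_true]
            field_simp
            ring
          · simp [he, he']
      simp only [e1, Finset.sum_add_distrib, Finset.sum_ite_eq', Finset.mem_univ, if_true]
      ring

namespace StarNetwork

variable {m n : ℕ} (N : StarNetwork m n)

/-- The logarithmic derivative `A' / A` at the end of a finite branch. -/
def endCoeff (j : Fin n) : ℝ :=
  N.ampDeriv (Sum.inr j) (N.tau j) / N.amp (Sum.inr j) (N.tau j)

/-- The sum of the logarithmic derivatives of the amplitudes at the central node. -/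
def nodeCoeff [NeZero m] : ℝ := (∑ e, N.ampDeriv e 0) / N.amp (Sum.inl 0) 0

/-- `y`, with derivative `y1`, solves the wave equation on the network together with the node and
end conditions. -/
structure IsState [NeZero m] (k : ℝ) (y y1 : Fin m ⊕ Fin n → ℝ → ℂ) : Prop where
  wave : ∀ e, IsWave (N.potential e) k (N.liouvilleBranch e) (y e) (y1 e)
  node : ∀ e e', y e 0 = y e' 0
  flux : ∑ e, y1 e 0 = N.nodeCoeff * y (Sum.inl 0) 0
  fin_end : ∀ j, y1 (Sum.inr j) (N.tau j) = N.endCoeff j * y (Sum.inr j) (N.tau j)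

/-- Outgoing solutions `u` on all branches and incoming solutions `v` on the infinite ones, with
their values at the central node at high frequency. -/
structure IsWaveBasis (M k : ℝ) (u u1 : Fin m ⊕ Fin n → ℝ → ℂ) (v v1 : Fin m → ℝ → ℂ) :
    Prop where
  jost : ∀ i, IsJost (N.potential (Sum.inl i)) k 1 (u (Sum.inl i)) (u1 (Sum.inl i))
  jost' : ∀ i, IsJost (N.potential (Sum.inl i)) k (-1) (v i) (v1 i)
  wave : ∀ j, IsWave (N.potential (Sum.inr j)) k (Icc 0 (N.tau j)) (u (Sum.inr j)) (u1 (Sum.inr j))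
  fin_val : ∀ j, u (Sum.inr j) (N.tau j) = 1
  fin_end : ∀ j, u1 (Sum.inr j) (N.tau j) = N.endCoeff j
  nondeg : ∀ j, u (Sum.inr j) 0 = 0 → u1 (Sum.inr j) 0 ≠ 0
  jost_val : ∀ i, ‖u (Sum.inl i) 0 - 1‖ ≤ M / k
  jost_deriv : ∀ i, ‖u1 (Sum.inl i) 0 - Complex.I * k‖ ≤ M
  jost_val' : ∀ i, ‖v i 0 - 1‖ ≤ M / k
  jost_deriv' : ∀ i, ‖v1 i 0 + Complex.I * k‖ ≤ M
  wave_val : ∀ j, ‖u (Sum.inr j) 0 - Real.cos (k * N.tau j)‖ ≤ M / k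
  wave_deriv : ∀ j, ‖u1 (Sum.inr j) 0 - k * Real.sin (k * N.tau j)‖ ≤ M

variable {N}

theorem IsWaveBasis.wave_all {M k : ℝ} {u u1 : Fin m ⊕ Fin n → ℝ → ℂ} {v v1 : Fin m → ℝ → ℂ}
    (h : N.IsWaveBasis M k u u1 v v1) (e : Fin m ⊕ Fin n) :
    IsWave (N.potential e) k (N.liouvilleBranch e) (u e) (u1 e) := by
  rcases e with i | j
  · exact (h.jost i).wave
  · exact h.wave j

namespace Assumptions

theorem exists_isWaveBasis (hN : N.Assumptions) : ∃ M, 1 ≤ M ∧ ∀ k, M ≤ k →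
    ∃ u u1 v v1, N.IsWaveBasis M k u u1 v v1 := by
  set I : Fin m ⊕ Fin n → ℝ := fun e => ∫ t in N.liouvilleBranch e, |N.potential e t| with hI
  have hI0 : ∀ e, 0 ≤ I e := fun e => integral_nonneg fun _ => abs_nonneg _
  -- One bound for all branches. The summand 1 also leaves room for the end slope `endCoeff j + 1`
  -- used for `nondeg`.
  set M : ℝ := 1 + ∑ e, 4 * I e + ∑ j, |N.endCoeff j| with hM
  have hs1 : 0 ≤ ∑ e, 4 * I e := Finset.sum_nonneg fun e _ => by linarith [hI0 e]
  have hs2 : 0 ≤ ∑ j, |N.endCoeff j| := Finset.sum_nonneg fun e _ => abs_nonneg _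
  have hIM : ∀ e, 4 * I e ≤ ∑ e, 4 * I e := fun e =>
    Finset.single_le_sum (f := fun e => 4 * I e) (fun e _ => by linarith [hI0 e])
      (Finset.mem_univ e)
  have hcM : ∀ j, |N.endCoeff j| ≤ ∑ j, |N.endCoeff j| := fun j =>
    Finset.single_le_sum (f := fun j => |N.endCoeff j|) (fun j _ => abs_nonneg _)
      (Finset.mem_univ j)
  refine ⟨M, by linarith, fun k hk => ?_⟩
  have hk0 : 0 < k := by linarith
  have H := fun e => hN.isAmplitude e
  have hjost : ∀ (σ : ℝ), σ ^ 2 = 1 → ∀ i : Fin m, ∃ f f1 : ℝ → ℂ,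
      IsJost (N.potential (Sum.inl i)) k σ f f1 ∧ ‖f 0 - 1‖ ≤ M / k ∧
        ‖f1 0 - σ * Complex.I * k‖ ≤ M := by
    intro σ hσ i
    have h1 := hIM (Sum.inl i)
    have h2 := hI0 (Sum.inl i)
    obtain ⟨f, f1, hf, ha, hb⟩ := (H (Sum.inl i)).exists_isJost hk0
      (show 2 * I (Sum.inl i) ≤ k by linarith) hσ
    refine ⟨f, f1, hf, ha.trans ?_, hb.trans (show 2 * I (Sum.inl i) ≤ M by linarith)⟩
    rw [div_mul_eq_mul_div]
    exact div_le_div_of_nonneg_right (show 2 * I (Sum.inl i) ≤ M by linarith) hk0.le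
  have hend : ∀ (j : Fin n) (c : ℝ), |c| ≤ k → ∃ f f1 : ℝ → ℂ,
      IsWave (N.potential (Sum.inr j)) k (Icc 0 (N.tau j)) f f1 ∧ f (N.tau j) = 1 ∧
        f1 (N.tau j) = c ∧ ‖f 0 - Real.cos (k * N.tau j)‖ ≤ (|c| + 4 * I (Sum.inr j)) / k ∧
        ‖f1 0 - k * Real.sin (k * N.tau j)‖ ≤ |c| + 4 * I (Sum.inr j) := by
    intro j c hc
    have h1 := hIM (Sum.inr j)
    have h2 := hI0 (Sum.inr j)
    exact (H (Sum.inr j)).exists_end_solution c hk0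
      (show 2 * I (Sum.inr j) ≤ k by linarith) hc
  choose f f1 hf hfa hfb using hjost 1 (by norm_num)
  choose g g1 hg hga hgb using hjost (-1) (by norm_num)
  choose φ φ1 hφ hφτ hφ1 hφa hφb using fun j => hend j (N.endCoeff j) (by linarith [hcM j])
  refine ⟨Sum.elim f φ, Sum.elim f1 φ1, g, g1, ⟨hf, hg, hφ, hφτ, hφ1, fun j h0 h1 => ?_, hfa,
    fun i => by simpa using hfb i, hga, fun i => by simpa using hgb i,
    fun j => (hφa j).trans ?_, fun j => (hφb j).trans ?_⟩⟩
  -- A second solution with end slope larger by 1 has Wronskian 1 with the first, so the first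
  -- cannot have zero Cauchy data at the node.
  · obtain ⟨z, z1, hz, hzτ, hz1, -⟩ := hend j (N.endCoeff j + 1) (by
      refine (abs_add_le _ _).trans ?_
      rw [abs_one]
      linarith [hcM j])
    have hτ := (hN.tau_pos j).le
    have hW := (hφ j).wronskian_eq ordConnected_Icc hz (left_mem_Icc.2 hτ) (right_mem_Icc.2 hτ)
    have h0' : φ j 0 = 0 := h0
    have h1' : φ1 j 0 = 0 := h1
    rw [h0', h1', hφτ, hφ1, hzτ, hz1] at hW
    simp at hW
  · exact div_le_div_of_nonneg_right (by linarith [hcM j, hIM (Sum.inr j)]) hk0.le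
  · linarith [hcM j, hIM (Sum.inr j)]

theorem isWave_of_solves {k : ℝ} {y : Fin m ⊕ Fin n → ℝ → ℂ} (h : N.SolvesSchrodinger k y)
    (e : Fin m ⊕ Fin n) :
    IsWave (N.potential e) k (N.liouvilleBranch e) (y e) (N.waveDeriv y e) :=
  ⟨fun x hx => ((h e).1.1 x hx).hasDerivWithinAt, fun x hx =>
    (((h e).1.2 x hx).hasDerivWithinAt).congr_deriv (by
      have := (h e).2 x hx
      rw [waveDeriv] at this
      linear_combination -this)⟩

/-- The difference z - tu tends to 0 at infinity, hence vanishes. This turns asymptotic conditions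
into data at the node. -/
theorem eq_outgoing {M k : ℝ} (hk : 0 < k) {u u1 : Fin m ⊕ Fin n → ℝ → ℂ}
    {v v1 : Fin m → ℝ → ℂ} (hb : N.IsWaveBasis M k u u1 v v1) {i : Fin m} {z z1 : ℝ → ℂ}
    (hz : IsWave (N.potential (Sum.inl i)) k (Ici 0) z z1) {t : ℂ}
    (ht : Tendsto (fun x : ℝ => z x - t * Complex.exp (Complex.I * k * x)) atTop (𝓝 0)) :
    z 0 = t * u (Sum.inl i) 0 ∧ z1 0 = t * u1 (Sum.inl i) 0 := by
  have h1 := (hb.jost i).eq_zero_of_tendsto hk (hb.jost' i)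
    (hz.sub ((hb.jost i).wave.const_mul t)) ?_ le_rfl
  · exact ⟨sub_eq_zero.1 h1.1, sub_eq_zero.1 h1.2⟩
  · have := ht.sub ((hb.jost i).tendsto.const_mul t)
    simp only [mul_zero, sub_zero] at this
    refine this.congr fun x => ?_
    simp
    ring

theorem eq_scattered {M k : ℝ} (hk : 0 < k) {u u1 : Fin m ⊕ Fin n → ℝ → ℂ}
    {v v1 : Fin m → ℝ → ℂ} (hb : N.IsWaveBasis M k u u1 v v1) {i : Fin m} {z z1 : ℝ → ℂ}
    (hz : IsWave (N.potential (Sum.inl i)) k (Ici 0) z z1) {r : ℂ}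
    (ht : Tendsto (fun x : ℝ => z x -
        (Complex.exp (-(Complex.I * k * x)) + r * Complex.exp (Complex.I * k * x))) atTop (𝓝 0)) :
    z 0 = v i 0 + r * u (Sum.inl i) 0 ∧ z1 0 = v1 i 0 + r * u1 (Sum.inl i) 0 := by
  have h1 := eq_outgoing hk hb (hz.sub (hb.jost' i).wave) (t := r) ?_
  · exact ⟨by linear_combination h1.1, by linear_combination h1.2⟩
  · have := ht.sub (hb.jost' i).tendsto
    simp only [sub_zero] at this
    refine this.congr fun x => ?_
    simp
    ring

/-- A zero of u at the node would kill the Wronskian of u with its conjugate, which is -2ik. -/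
theorem jost_ne_zero {M k : ℝ} (hk : 0 < k) {u u1 : Fin m ⊕ Fin n → ℝ → ℂ}
    {v v1 : Fin m → ℝ → ℂ} (hb : N.IsWaveBasis M k u u1 v v1) (i : Fin m) :
    u (Sum.inl i) 0 ≠ 0 := by
  intro h0
  have h1 := (hb.jost i).wronskian (hb.jost i).conj le_rfl
  have hk' : (k : ℂ) ≠ 0 := by exact_mod_cast hk.ne'
  rw [h0] at h1
  simp [hk'] at h1

theorem waveDeriv_eqOn (hN : N.Assumptions) {k : ℝ} {y y1 : Fin m ⊕ Fin n → ℝ → ℂ}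
    (h : ∀ e, IsWave (N.potential e) k (N.liouvilleBranch e) (y e) (y1 e)) (e : Fin m ⊕ Fin n) :
    EqOn (N.waveDeriv y e) (y1 e) (N.liouvilleBranch e) :=
  fun x hx => ((h e).deriv x hx).derivWithin (hN.uniqueDiffOn e x hx)

theorem solves_of_isWave (hN : N.Assumptions) {k : ℝ} {y y1 : Fin m ⊕ Fin n → ℝ → ℂ}
    (h : ∀ e, IsWave (N.potential e) k (N.liouvilleBranch e) (y e) (y1 e)) :
    N.SolvesSchrodinger k y := by
  intro e
  have h1 : ∀ x ∈ N.liouvilleBranch e, HasDerivWithinAt (N.waveDeriv y e)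
      (((N.potential e x : ℂ) - (k : ℂ) ^ 2) * y e x) (N.liouvilleBranch e) x := fun x hx =>
    ((h e).deriv2 x hx).congr_of_mem (fun z hz => hN.waveDeriv_eqOn h e hz) hx
  refine ⟨⟨fun x hx => ((h e).deriv x hx).differentiableWithinAt,
    fun x hx => (h1 x hx).differentiableWithinAt⟩, fun x hx => ?_⟩
  rw [(h1 x hx).derivWithin (hN.uniqueDiffOn e x hx)]
  ring

variable [NeZero m] (hN : N.Assumptions)
include hN

/-- By A5 all amplitudes agree at the node, so they cancel from both conditions except in
`nodeCoeff`. -/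
theorem kirchhoff_iff (y : Fin m ⊕ Fin n → ℝ → ℂ) : N.KirchhoffCondition y ↔
    (∀ e e', y e 0 = y e' 0) ∧
      ∑ e, N.waveDeriv y e 0 = N.nodeCoeff * y (Sum.inl 0) 0 := by
  set a := N.amp (Sum.inl 0) 0 with ha
  have ha0 : (a : ℂ) ≠ 0 := by
    exact_mod_cast ((hN.isAmplitude (Sum.inl 0)).pos 0 (hN.zero_mem _)).ne'
  have hae : ∀ e, N.amp e 0 = a := fun e => hN.amp_zero e (Sum.inl 0)
  have h1 : (∀ e e', ((N.amp e 0)⁻¹ : ℂ) * y e 0 = ((N.amp e' 0)⁻¹ : ℂ) * y e' 0) ↔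
      ∀ e e', y e 0 = y e' 0 := by
    simp only [hae]
    refine forall₂_congr fun e e' => mul_right_inj' (inv_ne_zero ha0)
  rw [KirchhoffCondition, h1]
  refine and_congr_right fun hy => ?_
  simp only [hae, fun e => hy e (Sum.inl 0), ← Finset.mul_sum, ← Finset.sum_mul, nodeCoeff]
  push_cast
  constructor
  · intro h
    field_simp
    linear_combination h
  · intro h
    rw [h]
    field_simp

theorem isReflectionCoeff_iff {k : ℝ} {r : ℂ} : N.IsReflectionCoeff k r ↔
    ∃ y y1, N.IsState k y y1 ∧
      Tendsto (fun x : ℝ => y (Sum.inl 0) x -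
        (Complex.exp (-(Complex.I * k * x)) + r * Complex.exp (Complex.I * k * x))) atTop (𝓝 0) ∧
      ∀ i : Fin m, i ≠ 0 → ∃ t : ℂ,
        Tendsto (fun x : ℝ => y (Sum.inl i) x - t * Complex.exp (Complex.I * k * x))
          atTop (𝓝 0) := by
  constructor
  · rintro ⟨y, hs, hK, hE, h0, hi⟩
    have hK' := (hN.kirchhoff_iff y).1 hK
    exact ⟨y, N.waveDeriv y, ⟨isWave_of_solves hs, hK'.1, hK'.2, hE⟩, h0, hi⟩
  · rintro ⟨y, y1, hs, h0, hi⟩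
    have hd := hN.waveDeriv_eqOn hs.wave
    refine ⟨y, hN.solves_of_isWave hs.wave, (hN.kirchhoff_iff y).2 ⟨hs.node, ?_⟩, fun j => ?_,
      h0, hi⟩
    · rw [← hs.flux]
      exact Finset.sum_congr rfl fun e _ => hd e (hN.zero_mem e)
    · rw [hd (Sum.inr j) ⟨(hN.tau_pos j).le, le_rfl⟩]
      exact hs.fin_end j

/-- Energy conservation: a state which is outgoing on all infinite branches vanishes on them. -/
theorem outgoing_eq_zero {M k : ℝ} (hk : 0 < k) {u u1 : Fin m ⊕ Fin n → ℝ → ℂ}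
    {v v1 : Fin m → ℝ → ℂ} (hb : N.IsWaveBasis M k u u1 v v1) {y y1 : Fin m ⊕ Fin n → ℝ → ℂ}
    (hy : N.IsState k y y1) {t : Fin m → ℂ}
    (ht : ∀ i, y (Sum.inl i) 0 = t i * u (Sum.inl i) 0 ∧
      y1 (Sum.inl i) 0 = t i * u1 (Sum.inl i) 0) : t = 0 := by
  -- The energy flux through the node into branch e, up to a constant. It is -2ik|t|² on infinite
  -- branches and 0 on finite ones, whose end condition is real; the total is 0 because `nodeCoeff`
  -- is real. All |t|² carry the same sign, so they vanish.
  set W : Fin m ⊕ Fin n → ℂ := fun e => y e 0 * star (y1 e 0) - y1 e 0 * star (y e 0) with hW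
  have hWl : ∀ i, W (Sum.inl i) = ((‖t i‖ ^ 2 : ℝ) : ℂ) * (-2 * Complex.I * k) := by
    intro i
    have h1 := (hb.jost i).wronskian (hb.jost i).conj le_rfl
    simp only [hW, (ht i).1, (ht i).2, star_mul']
    have h2 : t i * star (t i) = ((‖t i‖ ^ 2 : ℝ) : ℂ) := by
      rw [Complex.star_def, Complex.mul_conj, Complex.normSq_eq_norm_sq]
    rw [← h2]
    push_cast at h1
    linear_combination t i * star (t i) * h1
  have hWr : ∀ j, W (Sum.inr j) = 0 := by
    intro j
    have hτ := (hN.tau_pos j).le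
    have h1 := (hy.wave (Sum.inr j)).wronskian_eq (N.ordConnected_liouvilleBranch _)
      (hy.wave (Sum.inr j)).conj (hN.zero_mem _)
      (show N.tau j ∈ N.liouvilleBranch (Sum.inr j) from ⟨hτ, le_rfl⟩)
    simp only [hW]
    rw [h1, hy.fin_end j, star_mul', Complex.star_def, Complex.conj_ofReal]
    ring
  have hsum : ∑ e, W e = 0 := by
    have h1 : ∀ e, W e = y (Sum.inl 0) 0 * star (y1 e 0) - star (y (Sum.inl 0) 0) * y1 e 0 :=
      fun e => by simp only [hW, hy.node e (Sum.inl 0)]; ring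
    rw [Finset.sum_congr rfl fun e _ => h1 e, Finset.sum_sub_distrib, ← Finset.mul_sum,
      ← Finset.mul_sum, ← star_sum, hy.flux, star_mul', Complex.star_def,
      Complex.conj_ofReal]
    ring
  rw [Fintype.sum_sum_type, Finset.sum_congr rfl fun i _ => hWl i,
    Finset.sum_congr rfl fun j _ => hWr j, Finset.sum_const_zero, add_zero, ← Finset.sum_mul,
    ← Complex.ofReal_sum] at hsum
  have hne : -2 * Complex.I * (k : ℂ) ≠ 0 := by
    have : (k : ℂ) ≠ 0 := by exact_mod_cast hk.ne'
    simp [this]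
  have h0 : ∑ i, ‖t i‖ ^ 2 = 0 := by
    exact_mod_cast (mul_eq_zero.1 hsum).resolve_right hne
  ext i
  have := (Finset.sum_eq_zero_iff_of_nonneg fun i _ => by positivity).1 h0 i (Finset.mem_univ i)
  simpa using this

/-- The incoming waves cancel in the difference of two scattering states, which is thus outgoing
with amplitude r - r' on branch 0. The states themselves may differ, by a mode living on the finite
branches. -/
theorem reflectionCoeff_unique {M k : ℝ} (hk : 0 < k) {u u1 : Fin m ⊕ Fin n → ℝ → ℂ}
    {v v1 : Fin m → ℝ → ℂ} (hb : N.IsWaveBasis M k u u1 v v1) {r r' : ℂ}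
    (h : N.IsReflectionCoeff k r) (h' : N.IsReflectionCoeff k r') : r = r' := by
  obtain ⟨y, y1, hs, h0, hi⟩ := hN.isReflectionCoeff_iff.1 h
  obtain ⟨z, z1, hs', h0', hi'⟩ := hN.isReflectionCoeff_iff.1 h'
  have hd : N.IsState k (fun e x => y e x - z e x) (fun e x => y1 e x - z1 e x) := by
    refine ⟨fun e => (hs.wave e).sub (hs'.wave e), fun e e' => ?_, ?_, fun j => ?_⟩
    · rw [hs.node e e', hs'.node e e']
    · rw [Finset.sum_sub_distrib, hs.flux, hs'.flux]; ring
    · rw [hs.fin_end, hs'.fin_end]; ring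
  have hout : ∀ i : Fin m, ∃ t : ℂ, (i = 0 → t = r - r') ∧
      (y (Sum.inl i) 0 - z (Sum.inl i) 0 = t * u (Sum.inl i) 0 ∧
        y1 (Sum.inl i) 0 - z1 (Sum.inl i) 0 = t * u1 (Sum.inl i) 0) := by
    intro i
    by_cases h : i = 0
    · subst h
      have e1 := eq_scattered hk hb (hs.wave (Sum.inl 0)) h0
      have e2 := eq_scattered hk hb (hs'.wave (Sum.inl 0)) h0'
      exact ⟨r - r', fun _ => rfl, by linear_combination e1.1 - e2.1,
        by linear_combination e1.2 - e2.2⟩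
    · obtain ⟨t, ht⟩ := hi i h
      obtain ⟨t', ht'⟩ := hi' i h
      have e1 := eq_outgoing hk hb (hs.wave (Sum.inl i)) ht
      have e2 := eq_outgoing hk hb (hs'.wave (Sum.inl i)) ht'
      exact ⟨t - t', fun h' => absurd h' h, by linear_combination e1.1 - e2.1,
        by linear_combination e1.2 - e2.2⟩
  choose t ht ht' using hout
  have := hN.outgoing_eq_zero hk hb hd ht'
  have h2 := ht 0 rfl
  rw [this] at h2
  exact sub_eq_zero.1 h2.symm

theorem exists_reflectionCoeff {M k : ℝ} (hk : 0 < k) {u u1 : Fin m ⊕ Fin n → ℝ → ℂ}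
    {v v1 : Fin m → ℝ → ℂ} (hb : N.IsWaveBasis M k u u1 v v1) :
    ∃ r, N.IsReflectionCoeff k r := by
  have hne := jost_ne_zero hk hb
  obtain ⟨c, w, hc, hw⟩ := exists_node_coefficients (Sum.inl 0 : Fin m ⊕ Fin n)
    (fun e => u e 0) (fun e => u1 e 0) (v 0 0) (v1 0 0) N.nodeCoeff (hne 0)
    (fun e he => by
      rcases e with i | j
      · exact absurd he (hne i)
      · exact hb.nondeg j he)
    -- If the scalar equation were singular, the outgoing solutions normalized to 1 at the node
    -- would form a nonzero outgoing state, contradicting energy conservation.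
    (fun hu hsum => by
      have hst : N.IsState k (fun e x => (u e 0)⁻¹ * u e x) (fun e x => (u e 0)⁻¹ * u1 e x) := by
        refine ⟨fun e => (hb.wave_all e).const_mul _, fun e e' => ?_, ?_, fun j => ?_⟩
        · rw [inv_mul_cancel₀ (hu e), inv_mul_cancel₀ (hu e')]
        · rw [inv_mul_cancel₀ (hu _), mul_one, ← hsum]
          exact Finset.sum_congr rfl fun e _ => by ring
        · rw [hb.fin_end, hb.fin_val]; ring
      have := hN.outgoing_eq_zero hk hb hst (t := fun i => (u (Sum.inl i) 0)⁻¹)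
        fun i => ⟨rfl, rfl⟩
      exact inv_ne_zero (hne 0) (congrFun this 0))
  refine ⟨c (Sum.inl 0), hN.isReflectionCoeff_iff.2
    ⟨fun e x => c e * u e x + if e = Sum.inl 0 then v 0 x else 0,
      fun e x => c e * u1 e x + if e = Sum.inl 0 then v1 0 x else 0,
      ⟨fun e => ?_, fun e e' => ?_, ?_, fun j => ?_⟩, ?_, fun i hi => ⟨c (Sum.inl i), ?_⟩⟩⟩
  · by_cases he : e = Sum.inl 0
    · subst he
      simp only [if_true]
      exact ((hb.wave_all _).const_mul _).add (hb.jost' 0).wave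
    · simp only [if_neg he, add_zero]
      exact (hb.wave_all e).const_mul _
  · rw [hc e, hc e']
  · rw [hw, hc]
  · have : (Sum.inr j : Fin m ⊕ Fin n) ≠ Sum.inl 0 := by simp
    simp only [if_neg this, add_zero, hb.fin_end, hb.fin_val]
    ring
  · have := ((hb.jost 0).tendsto.const_mul (c (Sum.inl 0))).add (hb.jost' 0).tendsto
    simp only [mul_zero, add_zero] at this
    refine this.congr fun x => ?_
    simp
    ring
  · have hne' : (Sum.inl i : Fin m ⊕ Fin n) ≠ Sum.inl 0 := by simpa using hi
    have := (hb.jost i).tendsto.const_mul (c (Sum.inl i))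
    simp only [mul_zero] at this
    refine this.congr fun x => ?_
    simp [hne']
    ring

/-- The node equation for the reflection coefficient, off the Dirichlet eigenvalues of the finite
branches. -/
theorem reflectionCoeff_relation {M k : ℝ} (hk : 0 < k) {u u1 : Fin m ⊕ Fin n → ℝ → ℂ}
    {v v1 : Fin m → ℝ → ℂ} (hb : N.IsWaveBasis M k u u1 v v1) {r : ℂ}
    (h : N.IsReflectionCoeff k r) (hu : ∀ e, u e 0 ≠ 0) :
    v1 0 0 + r * u1 (Sum.inl 0) 0 +
      (∑ e ∈ Finset.univ.erase (Sum.inl 0), u1 e 0 / u e 0 - N.nodeCoeff) *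
        (v 0 0 + r * u (Sum.inl 0) 0) = 0 := by
  obtain ⟨y, y1, hs, h0, hi⟩ := hN.isReflectionCoeff_iff.1 h
  have e0 := eq_scattered hk hb (hs.wave (Sum.inl 0)) h0
  have hval : ∀ e ∈ Finset.univ.erase (Sum.inl 0 : Fin m ⊕ Fin n),
      y1 e 0 = u1 e 0 / u e 0 * y (Sum.inl 0) 0 := by
    intro e he
    rw [hs.node (Sum.inl 0) e]
    have := hu e
    suffices y1 e 0 * u e 0 = u1 e 0 * y e 0 by field_simp; linear_combination this
    rcases e with i | j
    · have hi0 : i ≠ 0 := fun h => by simp [h] at he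
      obtain ⟨t, ht⟩ := hi i hi0
      have e1 := eq_outgoing hk hb (hs.wave (Sum.inl i)) ht
      rw [e1.1, e1.2]; ring
    · have hτ := (hN.tau_pos j).le
      -- Both waves satisfy the same end condition, so their Wronskian vanishes at τ_j and hence at
      -- the node.
      have h1 := (hs.wave (Sum.inr j)).wronskian_eq (N.ordConnected_liouvilleBranch _)
        (hb.wave j) (hN.zero_mem _)
        (show N.tau j ∈ N.liouvilleBranch (Sum.inr j) from ⟨hτ, le_rfl⟩)
      rw [hs.fin_end j, hb.fin_end, hb.fin_val] at h1
      linear_combination -h1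
  have hf := hs.flux
  rw [← Finset.add_sum_erase _ _ (Finset.mem_univ (Sum.inl 0)), Finset.sum_congr rfl hval,
    ← Finset.sum_mul, e0.2, e0.1] at hf
  linear_combination hf

end Assumptions

end StarNetwork

/-! ### High-frequency asymptotics -/

theorem norm_div_sub_div_le {p q e₁ e₂ : ℂ} {ε : ℝ} (hp : ‖p‖ ≤ 1) (hq : ‖q‖ ≤ 1) (hq0 : q ≠ 0)
    (h1 : ‖e₁‖ ≤ ε) (h2 : ‖e₂‖ ≤ ε) (hε : 2 * ε ≤ ‖q‖) :
    q + e₁ ≠ 0 ∧ ‖(p + e₂) / (q + e₁) - p / q‖ ≤ 4 * ε / ‖q‖ ^ 2 := by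
  have hq' : 0 < ‖q‖ := norm_pos_iff.2 hq0
  have h3 : ‖q‖ / 2 ≤ ‖q + e₁‖ := by
    have := norm_sub_le_norm_add q e₁
    linarith
  have hne : q + e₁ ≠ 0 := norm_pos_iff.1 (by linarith)
  refine ⟨hne, ?_⟩
  have h4 : (p + e₂) / (q + e₁) - p / q = (e₂ * q - p * e₁) / ((q + e₁) * q) := by
    field_simp
    ring
  have hε0 : 0 ≤ ε := (norm_nonneg _).trans h1
  have h5 : ‖e₂ * q - p * e₁‖ ≤ 2 * ε := by
    refine (norm_sub_le _ _).trans ?_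
    rw [norm_mul, norm_mul]
    nlinarith [norm_nonneg e₁, norm_nonneg e₂, norm_nonneg p, norm_nonneg q]
  rw [h4, norm_div, norm_mul, div_le_div_iff₀ (by positivity) (by positivity)]
  have h6 : ‖q‖ ^ 2 ≤ 2 * (‖q + e₁‖ * ‖q‖) := by nlinarith
  calc ‖e₂ * q - p * e₁‖ * ‖q‖ ^ 2 ≤ 2 * ε * (2 * (‖q + e₁‖ * ‖q‖)) := by gcongr
    _ = _ := by ring

/-- Solving the relation gives 1/(1+r) = (b + Ga)/(b - b' + G(a - a')). Here b ≈ ik, b' ≈ -ik and a,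
a' ≈ 1, so the quotient is close to (ik + G)/(2ik). Both terms are divided by 2ik, giving `lam` and
`ρ`, with `ρ` close to 1. -/
theorem norm_inv_one_add_sub_le {M k : ℝ} (hM : 1 ≤ M) (hk : 0 < k) {a b a' b' G r : ℂ}
    (ha : ‖a - 1‖ ≤ M / k) (hb : ‖b - Complex.I * k‖ ≤ M) (ha' : ‖a' - 1‖ ≤ M / k)
    (hb' : ‖b' + Complex.I * k‖ ≤ M) (hrel : b' + r * b + G * (a' + r * a) = 0)
    (hg : 4 * M * (1 + ‖G / k‖) ≤ k) :
    ‖1 / (1 + r) - (1 - Complex.I * (G / k)) / 2‖ ≤ 3 * M * (1 + ‖G / k‖) ^ 2 / k := by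
  have hk' : (k : ℂ) ≠ 0 := by exact_mod_cast hk.ne'
  have hI := Complex.I_ne_zero
  set γ : ℂ := G / k with hγ
  set g : ℝ := 1 + ‖γ‖ with hgdef
  have hg1 : 1 ≤ g := by linarith [norm_nonneg γ]
  have hG : G = γ * k := by rw [hγ]; field_simp
  set lam : ℂ := (b + G * a) / (2 * Complex.I * k) with hlam
  set ρ : ℂ := (b - b' + G * (a - a')) / (2 * Complex.I * k) with hρ
  have hnk : ‖(2 * Complex.I * (k : ℂ))‖ = 2 * k := by
    simp [abs_of_pos hk]
  have hGn : ∀ z : ℂ, ‖z‖ ≤ M / k → ‖G * z‖ ≤ ‖γ‖ * M := by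
    intro z hz
    rw [hG, norm_mul, norm_mul, Complex.norm_real, Real.norm_eq_abs, abs_of_pos hk]
    calc ‖γ‖ * k * ‖z‖ ≤ ‖γ‖ * k * (M / k) := by gcongr
      _ = _ := by field_simp
  have h1 : ‖ρ - 1‖ ≤ M * g / k := by
    have e : ρ - 1 = ((b - Complex.I * k) - (b' + Complex.I * k) + G * (a - 1) - G * (a' - 1))
        / (2 * Complex.I * k) := by
      rw [hρ]; field_simp; ring
    rw [e, norm_div, hnk, div_le_div_iff₀ (by positivity) hk]
    have h2 : ‖(b - Complex.I * k) - (b' + Complex.I * k) + G * (a - 1) - G * (a' - 1)‖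
        ≤ M + M + ‖γ‖ * M + ‖γ‖ * M :=
      norm_sub_le_of_le (norm_add_le_of_le (norm_sub_le_of_le hb hb') (hGn _ ha)) (hGn _ ha')
    calc _ ≤ (M + M + ‖γ‖ * M + ‖γ‖ * M) * k := by gcongr
      _ = _ := by rw [hgdef]; ring
  have h2 : ‖lam - (1 - Complex.I * γ) / 2‖ ≤ M * g / (2 * k) := by
    have e : lam - (1 - Complex.I * γ) / 2 = ((b - Complex.I * k) + G * (a - 1))
        / (2 * Complex.I * k) := by
      rw [hlam, hG]
      field_simp
      linear_combination (γ * k) * Complex.I_sq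
    rw [e, norm_div, hnk]
    refine div_le_div_of_nonneg_right ?_ (by positivity)
    refine (norm_add_le_of_le hb (hGn _ ha)).trans (le_of_eq ?_)
    rw [hgdef]; ring
  have hsmall : M * g / k ≤ 1 / 4 := by
    rw [div_le_div_iff₀ hk (by norm_num)]; linarith
  have hρn : 3 / 4 ≤ ‖ρ‖ := by
    have := norm_sub_norm_le (1 : ℂ) ρ
    rw [norm_one, norm_sub_rev] at this
    linarith
  have hρ0 : ρ ≠ 0 := norm_pos_iff.1 (by linarith)
  have hrl : (1 + r) * lam = ρ := by
    rw [hlam, hρ]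
    field_simp
    linear_combination hrel
  have hr0 : 1 + r ≠ 0 := fun h => hρ0 (by rw [← hrl, h, zero_mul])
  have hinv : 1 / (1 + r) = lam / ρ := by
    rw [← hrl]
    have : lam ≠ 0 := fun h => hρ0 (by rw [← hrl, h, mul_zero])
    field_simp
  have hlamn : ‖lam‖ ≤ g := by
    have e : lam = (lam - (1 - Complex.I * γ) / 2) + (1 - Complex.I * γ) / 2 := by ring
    rw [e]
    have h3 : ‖(1 - Complex.I * γ) / 2‖ ≤ g / 2 := by
      rw [norm_div, Complex.norm_ofNat]
      refine div_le_div_of_nonneg_right ?_ (by norm_num)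
      refine (norm_sub_le _ _).trans ?_
      simp [hgdef]
    have h4 : M * g / (2 * k) = M * g / k / 2 := by field_simp
    refine (norm_add_le_of_le h2 h3).trans ?_
    rw [h4]; linarith
  have h3 : ‖lam / ρ - lam‖ ≤ 2 * M * g ^ 2 / k := by
    have e : lam / ρ - lam = lam * (1 - ρ) / ρ := by field_simp
    rw [e, norm_div, norm_mul, norm_sub_rev]
    rw [div_le_iff₀ (by linarith)]
    calc ‖lam‖ * ‖ρ - 1‖ ≤ g * (M * g / k) := by gcongr
      _ = 2 * M * g ^ 2 / k * (1 / 2) := by ring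
      _ ≤ 2 * M * g ^ 2 / k * ‖ρ‖ := by gcongr; linarith
  have e : 1 / (1 + r) - (1 - Complex.I * γ) / 2
      = (lam / ρ - lam) + (lam - (1 - Complex.I * γ) / 2) := by rw [hinv]; ring
  rw [e]
  refine (norm_add_le_of_le h3 h2).trans ?_
  have h5 : M * g / (2 * k) ≤ M * g ^ 2 / k := by
    rw [div_le_div_iff₀ (by positivity) hk]
    have : g ≤ g ^ 2 := by nlinarith
    have h6 : M * g ≤ M * g ^ 2 := by gcongr
    have h7 : 0 ≤ M * g ^ 2 * k := by positivity
    nlinarith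
  calc _ ≤ 2 * M * g ^ 2 / k + M * g ^ 2 / k := by gcongr
    _ = _ := by ring

namespace StarNetwork

variable {m n : ℕ} {N : StarNetwork m n}

/-- With G/k ≈ (m - 1)i + T, T the sum of tangents, (1 - iG/k)/2 becomes (m - iT)/2. The hypothesis
on k cos² enters twice: the quotients u'/(ku) have error O(1/(k cos²)), and tan² ≤ k/K offsets the
quadratic factor in `norm_inv_one_add_sub_le`. -/
theorem Assumptions.reflectionCoeff_asymptotics [NeZero m] (hN : N.Assumptions) :
    ∃ C K₀ : ℝ, 0 ≤ C ∧ 1 ≤ K₀ ∧ ∀ K, K₀ ≤ K → ∀ k, K ≤ k →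
      (∀ j, K ≤ k * Real.cos (k * N.tau j) ^ 2) → ∀ r, N.IsReflectionCoeff k r →
        ‖1 / (1 + r) - ((m : ℂ) - Complex.I * ((∑ j, Real.tan (k * N.tau j) : ℝ) : ℂ)) / 2‖
          ≤ C / K := by
  obtain ⟨M, hM, hbasis⟩ := hN.exists_isWaveBasis
  set C₁ : ℝ := (m + n) * (4 * M) + |N.nodeCoeff| with hC₁
  set C₂ : ℝ := 1 + m + n + C₁ with hC₂
  have hC₁0 : 0 ≤ C₁ := by positivity
  have hC₂1 : 1 ≤ C₂ := by
    have : (0 : ℝ) ≤ m + n := by positivity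
    linarith
  -- C₁/K bounds the error of G/k, halved in the result; C₂√(k/K) bounds 1 + |G/k|. The threshold is
  -- what `norm_inv_one_add_sub_le` requires.
  refine ⟨3 * M * C₂ ^ 2 + C₁ / 2, 4 * M * C₂ ^ 2, by positivity, by nlinarith, ?_⟩
  intro K hK k hKk hcos r hr
  have hK4 : 4 * M ≤ K := by
    have : 1 ≤ C₂ ^ 2 := one_le_pow₀ hC₂1
    nlinarith
  have hK0 : 0 < K := by linarith
  have hk0 : 0 < k := by linarith
  have hk' : (k : ℂ) ≠ 0 := by exact_mod_cast hk0.ne'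
  obtain ⟨u, u1, v, v1, hb⟩ := hbasis k (by linarith)
  have hMk : 2 * (M / k) ≤ 1 / 2 := by
    rw [← mul_div_assoc, div_le_div_iff₀ hk0 (by norm_num)]; linarith
  -- the quotients `u' / u` at the node
  have hinl : ∀ i, u (Sum.inl i) 0 ≠ 0 ∧
      ‖u1 (Sum.inl i) 0 / u (Sum.inl i) 0 / k - Complex.I‖ ≤ 4 * M / K := by
    intro i
    have h1 := norm_div_sub_div_le (p := Complex.I) (q := 1) (e₁ := u (Sum.inl i) 0 - 1)
      (e₂ := (u1 (Sum.inl i) 0 - Complex.I * k) / k) (ε := M / k) (by simp) (by simp) one_ne_zero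
      (hb.jost_val i) (by
        rw [norm_div, Complex.norm_real, Real.norm_eq_abs, abs_of_pos hk0]
        exact div_le_div_of_nonneg_right (hb.jost_deriv i) hk0.le) (by simp; linarith)
    rw [add_sub_cancel] at h1
    refine ⟨h1.1, ?_⟩
    have e : u1 (Sum.inl i) 0 / u (Sum.inl i) 0 / k - Complex.I =
        (Complex.I + (u1 (Sum.inl i) 0 - Complex.I * k) / k) / u (Sum.inl i) 0
          - Complex.I / 1 := by
      have := h1.1
      field_simp
      ring
    rw [e]
    refine h1.2.trans ?_
    rw [norm_one, one_pow, div_one, ← mul_div_assoc]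
    gcongr
  have hc0 : ∀ j, Real.cos (k * N.tau j) ≠ 0 := fun j h => by
    have := hcos j
    rw [h] at this
    simp at this
    linarith
  have hinr : ∀ j, u (Sum.inr j) 0 ≠ 0 ∧
      ‖u1 (Sum.inr j) 0 / u (Sum.inr j) 0 / k - (Real.tan (k * N.tau j) : ℂ)‖ ≤ 4 * M / K := by
    intro j
    set c := Real.cos (k * N.tau j) with hc
    set s := Real.sin (k * N.tau j) with hs
    have hcj : K ≤ k * c ^ 2 := hcos j
    have hcn : ‖(c : ℂ)‖ = |c| := by rw [Complex.norm_real, Real.norm_eq_abs]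
    have hc1 : |c| ≤ 1 := Real.abs_cos_le_one _
    have hcc : c ^ 2 ≤ |c| := by rw [← sq_abs]; nlinarith [abs_nonneg c]
    have hcne : (c : ℂ) ≠ 0 := by exact_mod_cast hc0 j
    have h1 := norm_div_sub_div_le (p := (s : ℂ)) (q := (c : ℂ)) (e₁ := u (Sum.inr j) 0 - c)
      (e₂ := (u1 (Sum.inr j) 0 - k * s) / k) (ε := M / k)
      (by rw [Complex.norm_real, Real.norm_eq_abs]; exact Real.abs_sin_le_one _)
      (by rwa [hcn]) hcne (hb.wave_val j) (by
        rw [norm_div, Complex.norm_real, Real.norm_eq_abs, abs_of_pos hk0]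
        exact div_le_div_of_nonneg_right (hb.wave_deriv j) hk0.le) (by
        rw [hcn, ← mul_div_assoc, div_le_iff₀ hk0]
        nlinarith)
    rw [add_sub_cancel] at h1
    refine ⟨h1.1, ?_⟩
    have e : u1 (Sum.inr j) 0 / u (Sum.inr j) 0 / k - (Real.tan (k * N.tau j) : ℂ) =
        (s + (u1 (Sum.inr j) 0 - k * s) / k) / u (Sum.inr j) 0 - s / c := by
      have := h1.1
      rw [Real.tan_eq_sin_div_cos, ← hc, ← hs]
      push_cast
      field_simp
      ring
    rw [e]
    refine h1.2.trans ?_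
    rw [hcn, sq_abs, ← mul_div_assoc, div_div]
    gcongr
  have hu : ∀ e, u e 0 ≠ 0 := by
    rintro (i | j)
    · exact (hinl i).1
    · exact (hinr j).1
  have hrel := hN.reflectionCoeff_relation hk0 hb hr hu
  set G : ℂ := ∑ e ∈ Finset.univ.erase (Sum.inl 0 : Fin m ⊕ Fin n), u1 e 0 / u e 0
    - N.nodeCoeff with hG
  set T : ℝ := ∑ j, Real.tan (k * N.tau j) with hT
  set target : Fin m ⊕ Fin n → ℂ :=
    Sum.elim (fun _ => Complex.I) (fun j => (Real.tan (k * N.tau j) : ℂ)) with htarget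
  have htsum : ∑ e ∈ Finset.univ.erase (Sum.inl 0 : Fin m ⊕ Fin n), target e
      = m * Complex.I + T - Complex.I := by
    rw [Finset.sum_erase_eq_sub (Finset.mem_univ _), Fintype.sum_sum_type]
    simp [htarget, hT]
  have hγ : ‖G / k - (m * Complex.I + T - Complex.I)‖ ≤ C₁ / K := by
    have e : G / k - (m * Complex.I + T - Complex.I)
        = ∑ e ∈ Finset.univ.erase (Sum.inl 0 : Fin m ⊕ Fin n), (u1 e 0 / u e 0 / k - target e)
          - (N.nodeCoeff / k : ℝ) := by
      rw [Finset.sum_sub_distrib, htsum, ← Finset.sum_div, hG]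
      push_cast
      ring
    rw [e]
    have h1 : ‖∑ e ∈ Finset.univ.erase (Sum.inl 0 : Fin m ⊕ Fin n),
        (u1 e 0 / u e 0 / k - target e)‖ ≤ (m + n) * (4 * M / K) := by
      refine (norm_sum_le_of_le (f := fun e => u1 e 0 / u e 0 / k - target e)
        (n := fun _ => 4 * M / K) _ fun e _ => ?_).trans ?_
      · rcases e with i | j
        · exact (hinl i).2
        · exact (hinr j).2
      · rw [Finset.sum_const, nsmul_eq_mul]
        refine mul_le_mul_of_nonneg_right ?_ (by positivity)
        have : (Finset.univ.erase (Sum.inl 0 : Fin m ⊕ Fin n)).card ≤ m + n :=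
          (Finset.card_le_univ _).trans (by simp)
        exact_mod_cast this
    have h2 : ‖((N.nodeCoeff / k : ℝ) : ℂ)‖ ≤ |N.nodeCoeff| / K := by
      rw [Complex.norm_real, Real.norm_eq_abs, abs_div, abs_of_pos hk0]
      gcongr
    refine (norm_sub_le_of_le h1 h2).trans (le_of_eq ?_)
    rw [hC₁]; ring
  -- A bound for every |tan(kτ_j)|. Its square divided by k is 1/K, the desired order of the error.
  set s := Real.sqrt (k / K) with hs
  have hs1 : 1 ≤ s := Real.one_le_sqrt.2 ((one_le_div hK0).2 hKk)
  have hs2 : s ^ 2 = k / K := Real.sq_sqrt (by positivity)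
  have htan : ∀ j, |Real.tan (k * N.tau j)| ≤ s := by
    intro j
    refine Real.abs_le_sqrt ?_
    have hcj := hcos j
    rw [Real.tan_eq_sin_div_cos, div_pow, div_le_div_iff₀ (by have := hc0 j; positivity) hK0]
    have h1 : Real.sin (k * N.tau j) ^ 2 ≤ 1 := Real.sin_sq_le_one _
    nlinarith
  have hTn : |T| ≤ n * s := by
    refine (Finset.abs_sum_le_sum_abs _ _).trans ?_
    refine (Finset.sum_le_sum fun j _ => htan j).trans (le_of_eq ?_)
    simp
  have hm1 : (1 : ℝ) ≤ m := by
    exact_mod_cast Nat.one_le_iff_ne_zero.2 (NeZero.ne m)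
  have hg : 1 + ‖G / k‖ ≤ C₂ * s := by
    have e : G / k = (G / k - (m * Complex.I + T - Complex.I))
        + (((m - 1 : ℝ) : ℂ) * Complex.I + T) := by push_cast; ring
    have h1 : ‖((m - 1 : ℝ) : ℂ) * Complex.I + (T : ℂ)‖ ≤ (m - 1) + n * s := by
      refine norm_add_le_of_le ?_ ?_
      · rw [norm_mul, Complex.norm_I, mul_one, Complex.norm_real, Real.norm_eq_abs,
          abs_of_nonneg (by linarith)]
      · rwa [Complex.norm_real, Real.norm_eq_abs]
    have h2 : ‖G / k‖ ≤ C₁ / K + ((m - 1) + n * s) := by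
      rw [e]; exact norm_add_le_of_le hγ h1
    have h3 : C₁ / K ≤ C₁ := div_le_self hC₁0 (by linarith)
    have h4 : C₁ ≤ C₁ * s := le_mul_of_one_le_right hC₁0 hs1
    have h5 : (m : ℝ) ≤ m * s := le_mul_of_one_le_right (by positivity) hs1
    rw [hC₂]
    nlinarith
  have hg2 : (1 + ‖G / k‖) ^ 2 ≤ C₂ ^ 2 * (k / K) := by
    rw [← hs2, ← mul_pow]
    gcongr
  have hgk : 4 * M * (1 + ‖G / k‖) ≤ k := by
    have h1 : 1 + ‖G / k‖ ≤ (1 + ‖G / k‖) ^ 2 := by nlinarith [norm_nonneg (G / k)]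
    calc 4 * M * (1 + ‖G / k‖) ≤ 4 * M * (C₂ ^ 2 * (k / K)) := by
          gcongr; exact h1.trans hg2
      _ = 4 * M * C₂ ^ 2 / K * k := by ring
      _ ≤ 1 * k := by gcongr; exact (div_le_one hK0).2 hK
      _ = k := one_mul k
  have hmain := norm_inv_one_add_sub_le hM hk0 (hb.jost_val 0) (hb.jost_deriv 0) (hb.jost_val' 0)
    (hb.jost_deriv' 0) hrel hgk
  have e : 1 / (1 + r) - ((m : ℂ) - Complex.I * (T : ℂ)) / 2
      = (1 / (1 + r) - (1 - Complex.I * (G / k)) / 2)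
        - Complex.I / 2 * (G / k - (m * Complex.I + T - Complex.I)) := by
    linear_combination (-(m : ℂ) / 2 + 1 / 2) * Complex.I_sq
  rw [e]
  have h1 : 3 * M * (1 + ‖G / k‖) ^ 2 / k ≤ 3 * M * C₂ ^ 2 / K := by
    calc _ ≤ 3 * M * (C₂ ^ 2 * (k / K)) / k := by gcongr
      _ = _ := by field_simp
  have h2 : ‖Complex.I / 2 * (G / k - (m * Complex.I + T - Complex.I))‖ ≤ C₁ / 2 / K := by
    rw [norm_mul, norm_div, Complex.norm_I, Complex.norm_ofNat]
    calc _ ≤ 1 / 2 * (C₁ / K) := by gcongr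
      _ = _ := by ring
  refine (norm_sub_le_of_le (hmain.trans h1) h2).trans (le_of_eq ?_)
  ring

end StarNetwork

/-! ### Uniform frequency shifts and the poles of tangent sums -/

/-- A shift s that works for θ works with a margin on a neighbourhood of θ, since tan is continuous
off its poles. Finitely many neighbourhoods cover X, and the least margin serves. -/
theorem exists_uniform_shift {ι : Type*} [Fintype ι] (τ c : ι → ℝ) {X : Set (ι → ℝ)}
    (hX : IsCompact X) (I : Set ℝ) (M : ℝ)
    (h : ∀ θ ∈ X, ∃ s ∈ I, (∀ i, Real.cos (θ i + s * τ i) ≠ 0) ∧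
      M < |∑ i, c i * Real.tan (θ i + s * τ i)|) :
    ∃ ε, 0 < ε ∧ ∀ θ ∈ X, ∃ s ∈ I, (∀ i, ε ≤ |Real.cos (θ i + s * τ i)|) ∧
      M + ε ≤ |∑ i, c i * Real.tan (θ i + s * τ i)| := by
  refine hX.induction_on (p := fun S => ∃ ε, 0 < ε ∧ ∀ θ ∈ S, ∃ s ∈ I,
    (∀ i, ε ≤ |Real.cos (θ i + s * τ i)|) ∧ M + ε ≤ |∑ i, c i * Real.tan (θ i + s * τ i)|)
    ⟨1, one_pos, by simp⟩ ?_ ?_ ?_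
  · rintro S S' hS ⟨ε, hε, H⟩
    exact ⟨ε, hε, fun θ hθ => H θ (hS hθ)⟩
  · rintro S S' ⟨ε, hε, H⟩ ⟨ε', hε', H'⟩
    refine ⟨min ε ε', lt_min hε hε', ?_⟩
    rintro θ (hθ | hθ)
    · obtain ⟨s, hs, h1, h2⟩ := H θ hθ
      exact ⟨s, hs, fun i => (min_le_left _ _).trans (h1 i),
        (add_le_add_right (min_le_left _ _) M).trans h2⟩
    · obtain ⟨s, hs, h1, h2⟩ := H' θ hθ
      exact ⟨s, hs, fun i => (min_le_right _ _).trans (h1 i),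
        (add_le_add_right (min_le_right _ _) M).trans h2⟩
  · intro θ hθ
    obtain ⟨s, hs, h1, h2⟩ := h θ hθ
    have hε : ∀ᶠ ε : ℝ in 𝓝[>] 0, (∀ i, ε < |Real.cos (θ i + s * τ i)|) ∧
        M + ε < |∑ i, c i * Real.tan (θ i + s * τ i)| := by
      refine Filter.Eventually.and ?_ ?_
      · exact eventually_all.2 fun i =>
          nhdsWithin_le_nhds (eventually_lt_nhds (abs_pos.2 (h1 i)))
      · refine nhdsWithin_le_nhds ?_
        have : Tendsto (fun ε : ℝ => M + ε) (𝓝 0) (𝓝 (M + 0)) :=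
          (continuous_const.add continuous_id).tendsto 0
        rw [add_zero] at this
        exact this.eventually_lt_const h2
    obtain ⟨ε, ⟨ha, hb⟩, hε0⟩ := (hε.and self_mem_nhdsWithin).exists
    have hcont : ∀ i, ContinuousAt (fun θ' : ι → ℝ => θ' i + s * τ i) θ := fun i =>
      (continuous_apply i).continuousAt.add continuousAt_const
    have e1 : ∀ᶠ θ' in 𝓝 θ, ∀ i, ε < |Real.cos (θ' i + s * τ i)| :=
      eventually_all.2 fun i =>
        ((Real.continuous_cos.continuousAt.comp (hcont i)).abs).eventually_const_lt (ha i)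
    have e2 : ∀ᶠ θ' in 𝓝 θ, M + ε < |∑ i, c i * Real.tan (θ' i + s * τ i)| := by
      have hc : ContinuousAt (fun θ' : ι → ℝ => |∑ i, c i * Real.tan (θ' i + s * τ i)|) θ := by
        refine ContinuousAt.abs (tendsto_finsetSum _ fun i _ => ?_)
        exact continuousAt_const.mul
          (ContinuousAt.comp (f := fun θ' : ι → ℝ => θ' i + s * τ i)
            (Real.continuousAt_tan.2 (h1 i)) (hcont i))
      exact hc.eventually_const_lt hb
    refine ⟨_, nhdsWithin_le_nhds (e1.and e2), ε, hε0, fun θ' hθ' => ⟨s, hs, ?_, ?_⟩⟩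
    · exact fun i => (hθ'.1 i).le
    · exact hθ'.2.le

/-- The conclusion of `exists_uniform_shift` for the phases `k τ_i`, reduced modulo `π`. -/
theorem exists_uniform_frequency_shift {ι : Type*} [Fintype ι] (τ c : ι → ℝ)
    {Y : Set (ι → ℝ)} (hY : IsClosed Y) (I : Set ℝ) (M : ℝ)
    (h : ∀ θ ∈ Y, ∃ s ∈ I, (∀ i, Real.cos (θ i + s * τ i) ≠ 0) ∧
      M < |∑ i, c i * Real.tan (θ i + s * τ i)|) :
    ∃ ε, 0 < ε ∧ ∀ k : ℝ, (∀ N : ι → ℤ, (fun i => k * τ i - N i * Real.pi) ∈ Y) →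
      ∃ s ∈ I, (∀ i, ε ≤ |Real.cos ((k + s) * τ i)|) ∧
        M + ε ≤ |∑ i, c i * Real.tan ((k + s) * τ i)| := by
  have hcpt : IsCompact (Set.pi univ (fun _ : ι => Icc 0 Real.pi) ∩ Y) :=
    (isCompact_univ_pi fun _ => isCompact_Icc).inter_right hY
  obtain ⟨ε, hε, H⟩ := exists_uniform_shift τ c hcpt I M fun θ hθ => h θ hθ.2
  refine ⟨ε, hε, fun k hk => ?_⟩
  have hpi := Real.pi_pos
  -- Reduction into [0, π]; neither tan nor |cos| sees multiples of π.
  obtain ⟨s, hs, h1, h2⟩ := H (fun i => k * τ i - ⌊k * τ i / Real.pi⌋ * Real.pi) ⟨fun i _ => by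
    have h1 := Int.floor_le (k * τ i / Real.pi)
    have h2 := (Int.lt_floor_add_one (k * τ i / Real.pi)).le
    rw [le_div_iff₀ hpi] at h1
    rw [div_le_iff₀ hpi] at h2
    constructor <;> simp only <;> linarith, hk _⟩
  have e : ∀ i, k * τ i - ⌊k * τ i / Real.pi⌋ * Real.pi + s * τ i
      = (k + s) * τ i - ⌊k * τ i / Real.pi⌋ * Real.pi := fun i => by ring
  refine ⟨s, hs, fun i => ?_, ?_⟩
  · have := h1 i
    rw [e, Real.cos_sub_int_mul_pi, abs_mul, abs_zpow, abs_neg, abs_one, one_zpow, one_mul] at this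
    exact this
  · simp only [e, Real.tan_sub_int_mul_pi] at h2
    exact h2

theorem countable_cos_eq_zero {θ τ : ℝ} (hτ : 0 < τ) :
    {s : ℝ | Real.cos (θ + s * τ) = 0}.Countable := by
  have h : {x : ℝ | Real.cos x = 0}.Countable := by
    refine (countable_range fun n : ℤ => (2 * n + 1) * Real.pi / 2).mono fun x hx => ?_
    obtain ⟨n, hn⟩ := Real.cos_eq_zero_iff.1 hx
    exact ⟨n, hn.symm⟩
  exact h.preimage fun a b hab => mul_right_cancel₀ hτ.ne' (add_left_cancel hab)

theorem frequently_cos_ne_zero {ι : Type*} [Finite ι] (θ : ι → ℝ) {τ : ι → ℝ} (hτ : ∀ i, 0 < τ i)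
    (x : ℝ) : ∃ᶠ s in 𝓝[≠] x, ∀ i, Real.cos (θ i + s * τ i) ≠ 0 := by
  have hB : (⋃ i, {s : ℝ | Real.cos (θ i + s * τ i) = 0}).Countable :=
    countable_iUnion fun i => countable_cos_eq_zero (hτ i)
  have hd := (hB.insert x).dense_compl ℝ x
  rw [frequently_nhdsWithin_iff]
  refine (mem_closure_iff_frequently.1 hd).mono fun s hs => ?_
  simp only [mem_compl_iff, mem_insert_iff, mem_iUnion, not_or, not_exists] at hs
  exact ⟨hs.2, hs.1⟩

theorem exists_cos_ne_zero {ι : Type*} [Finite ι] (θ : ι → ℝ) {τ : ι → ℝ} (hτ : ∀ i, 0 < τ i)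
    {ℓ : ℝ} (hℓ : 0 < ℓ) : ∃ s ∈ Icc 0 ℓ, ∀ i, Real.cos (θ i + s * τ i) ≠ 0 := by
  have h1 : ∀ᶠ s in 𝓝[≠] (ℓ / 2), s ∈ Icc 0 ℓ :=
    nhdsWithin_le_nhds (Icc_mem_nhds (by linarith) (by linarith))
  obtain ⟨s, h, hs⟩ := ((frequently_cos_ne_zero θ hτ (ℓ / 2)).and_eventually h1).exists
  exact ⟨s, hs, h⟩

theorem tendsto_tan_left {θ τ : ℝ} (hτ : 0 < τ) (hθ : Real.cos θ = 0) :
    Tendsto (fun s : ℝ => Real.tan (θ + s * τ)) (𝓝[<] 0) atTop ∧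
      ∀ᶠ s in 𝓝[<] (0 : ℝ), Real.cos (θ + s * τ) ≠ 0 := by
  obtain ⟨N, hN⟩ := Real.cos_eq_zero_iff.1 hθ
  have e : ∀ s : ℝ, θ + s * τ = (Real.pi / 2 + s * τ) + N * Real.pi := fun s => by rw [hN]; ring
  have hlim : Tendsto (fun s : ℝ => Real.pi / 2 + s * τ) (𝓝[<] 0) (𝓝[<] (Real.pi / 2)) := by
    refine tendsto_nhdsWithin_iff.2 ⟨?_, ?_⟩
    · have : Tendsto (fun s : ℝ => Real.pi / 2 + s * τ) (𝓝 0) (𝓝 (Real.pi / 2 + 0 * τ)) :=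
        (by fun_prop : Continuous fun s : ℝ => Real.pi / 2 + s * τ).tendsto 0
      rw [zero_mul, add_zero] at this
      exact this.mono_left nhdsWithin_le_nhds
    · filter_upwards [self_mem_nhdsWithin] with s hs
      have : s * τ < 0 := mul_neg_of_neg_of_pos hs hτ
      rw [mem_Iio]
      linarith
  constructor
  · refine (Real.tendsto_tan_pi_div_two.comp hlim).congr fun s => ?_
    rw [Function.comp, e, Real.tan_add_int_mul_pi]
  · have hpi := Real.pi_pos
    have : ∀ᶠ x in 𝓝[<] (Real.pi / 2), Real.cos x ≠ 0 := by
      filter_upwards [Ioo_mem_nhdsLT (show -(Real.pi / 2) < Real.pi / 2 by linarith)] with x hx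
      exact (Real.cos_pos_of_mem_Ioo hx).ne'
    filter_upwards [hlim.eventually this] with s hs
    rw [e, Real.cos_add_int_mul_pi]
    exact mul_ne_zero (zpow_ne_zero _ (by norm_num)) hs

/-- The poles of a sum of tangents do not cancel. -/
theorem exists_large_tan_sum {ι : Type*} [Fintype ι] {τ : ι → ℝ} (hτ : ∀ i, 0 < τ i)
    {θ : ι → ℝ} {j : ι} (hj : Real.cos (θ j) = 0) {η : ℝ} (hη : 0 < η) (M : ℝ) :
    ∃ s ∈ Ioo (-η) η, (∀ i, Real.cos (θ i + s * τ i) ≠ 0) ∧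
      M < |∑ i, 1 * Real.tan (θ i + s * τ i)| := by
  classical
  have hcont : ∀ i, ContinuousAt (fun s : ℝ => θ i + s * τ i) 0 := fun i => by fun_prop
  have h1 : ∀ᶠ s in 𝓝[<] (0 : ℝ), ∀ i, Real.cos (θ i + s * τ i) ≠ 0 := by
    refine eventually_all.2 fun i => ?_
    by_cases hi : Real.cos (θ i) = 0
    · exact (tendsto_tan_left (hτ i) hi).2
    · refine nhdsWithin_le_nhds ?_
      have := Real.continuous_cos.continuousAt.comp (hcont i)
      exact this.eventually_ne (by simpa using hi)
  -- To the left of 0 every term is bounded below, as those with a pole there tend to +∞; so the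
  -- pole of term j survives in the sum.
  have h2 : ∀ i, ∃ C, ∀ᶠ s in 𝓝[<] (0 : ℝ), C ≤ Real.tan (θ i + s * τ i) := by
    intro i
    by_cases hi : Real.cos (θ i) = 0
    · exact ⟨0, (tendsto_tan_left (hτ i) hi).1.eventually_ge_atTop 0⟩
    · refine ⟨Real.tan (θ i) - 1, nhdsWithin_le_nhds ?_⟩
      have : ContinuousAt (fun s : ℝ => Real.tan (θ i + s * τ i)) 0 :=
        ContinuousAt.comp (f := fun s : ℝ => θ i + s * τ i)
          (Real.continuousAt_tan.2 (by simpa using hi)) (hcont i)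
      exact this.eventually_const_le (by simp)
  choose C hC using h2
  have h3 : Tendsto (fun s : ℝ => ∑ i, 1 * Real.tan (θ i + s * τ i)) (𝓝[<] 0) atTop := by
    have h4 : ∀ᶠ s in 𝓝[<] (0 : ℝ), Real.tan (θ j + s * τ j) + ∑ i ∈ Finset.univ.erase j, C i
        ≤ ∑ i, 1 * Real.tan (θ i + s * τ i) := by
      filter_upwards [eventually_all.2 hC] with s hs
      rw [← Finset.add_sum_erase _ _ (Finset.mem_univ j), one_mul]
      gcongr with i _
      rw [one_mul]
      exact hs i
    exact tendsto_atTop_mono' _ h4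
      (tendsto_atTop_add_const_right _ _ (tendsto_tan_left (hτ j) hj).1)
  have h5 : ∀ᶠ s in 𝓝[<] (0 : ℝ), s ∈ Ioo (-η) η :=
    nhdsWithin_le_nhds (Ioo_mem_nhds (by linarith) hη)
  obtain ⟨s, ⟨hs1, hs2⟩, hs3⟩ := ((h1.and h5).and (h3.eventually_gt_atTop M)).exists
  exact ⟨s, hs2, hs1, hs3.trans_le (le_abs_self _)⟩

/-! ### Independence of tangents with distinct rates -/

/-- Exponentially decaying functions with distinct rates are independent. -/
theorem leading_coeff_eq_zero (T : Finset ℝ) (h : ℝ → ℝ → ℂ) (c : ℝ → ℂ)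
    (hlim : ∀ t ∈ T, Tendsto (fun σ => h t σ * (Real.exp (2 * t * σ) : ℂ)) atTop (𝓝 (c t)))
    (hzero : ∀ t ∈ T, c t = 0 → ∀ σ, h t σ = 0)
    (hsum : ∀ σ, 0 < σ → ∑ t ∈ T, h t σ = 0) : ∀ t ∈ T, c t = 0 := by
  induction T using Finset.induction_on_min with
  | empty => simp
  | insert a s ha ih =>
    have hane : a ∉ s := fun h => lt_irrefl _ (ha a h)
    -- The inserted rate a is the smallest: after multiplication by e^{2aσ} all other terms tend to
    -- 0.
    have hca : c a = 0 := by
      have h1 : ∀ t ∈ s, Tendsto (fun σ => h t σ * (Real.exp (2 * a * σ) : ℂ)) atTop (𝓝 0) := by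
        intro t ht
        have h2 : Tendsto (fun σ : ℝ => ((Real.exp (2 * (a - t) * σ) : ℝ) : ℂ)) atTop (𝓝 0) := by
          have : Tendsto (fun σ : ℝ => Real.exp (2 * (a - t) * σ)) atTop (𝓝 0) :=
            Real.tendsto_exp_atBot.comp
              (tendsto_id.const_mul_atTop_of_neg (by linarith [ha t ht]))
          have h3 := (Complex.continuous_ofReal.tendsto 0).comp this
          rwa [Complex.ofReal_zero] at h3
        have h3 := (hlim t (Finset.mem_insert_of_mem ht)).mul h2
        rw [mul_zero] at h3
        refine h3.congr fun σ => ?_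
        rw [mul_assoc, ← Complex.ofReal_mul, ← Real.exp_add]
        congr 3
        ring
      have h4 := (hlim a (Finset.mem_insert_self a s)).add (tendsto_finsetSum s h1)
      rw [Finset.sum_const_zero, add_zero] at h4
      refine tendsto_nhds_unique h4 (tendsto_const_nhds.congr' ?_)
      filter_upwards [eventually_gt_atTop 0] with σ hσ
      have h5 := hsum σ hσ
      rw [Finset.sum_insert hane] at h5
      rw [← Finset.sum_mul, ← add_mul, h5, zero_mul]
    -- A zero leading coefficient must kill the whole term, because its higher exponentials could
    -- interfere with the other rates. That is the role of `hzero`.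
    have ih' := ih (fun t ht => hlim t (Finset.mem_insert_of_mem ht))
      (fun t ht => hzero t (Finset.mem_insert_of_mem ht)) (fun σ hσ => by
        have := hsum σ hσ
        rwa [Finset.sum_insert hane, hzero a (Finset.mem_insert_self a s) hca σ, zero_add] at this)
    intro t ht
    rcases Finset.mem_insert.1 ht with rfl | ht
    · exact hca
    · exact ih' t ht

theorem cos_ne_zero_of_im_pos {w : ℂ} (hw : 0 < w.im) : Complex.cos w ≠ 0 := by
  intro h
  obtain ⟨n, hn⟩ := Complex.cos_eq_zero_iff.1 h
  have : w.im = 0 := by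
    rw [hn, show (2 * (n : ℂ) + 1) * (Real.pi : ℂ) / 2 = (((2 * n + 1) * Real.pi / 2 : ℝ) : ℂ) by
      push_cast; ring]
    exact Complex.ofReal_im _
  exact hw.ne' this

/-- A linear relation between tangents on an interval extends to the upper imaginary axis. -/
theorem tan_sum_eq_zero_upper {ι : Type*} [Fintype ι] {τ : ι → ℝ} (hτ : ∀ i, 0 < τ i)
    (θ c : ι → ℝ) {ℓ : ℝ} (hℓ : 0 < ℓ)
    (h : ∀ s ∈ Icc 0 ℓ, (∀ i, Real.cos (θ i + s * τ i) ≠ 0) →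
      ∑ i, c i * Real.tan (θ i + s * τ i) = 0) {σ : ℝ} (hσ : 0 < σ) :
    ∑ i, (c i : ℂ) * Complex.tan (θ i + Complex.I * σ * τ i) = 0 := by
  classical
  -- The sum of tangents cleared of denominators: an entire function, so the identity theorem
  -- applies. On the upper imaginary axis the cosines do not vanish and can be divided out again.
  set F : ℂ → ℂ := fun z => ∑ i, (c i : ℂ) * (Complex.sin (θ i + z * τ i) *
    ∏ j ∈ Finset.univ.erase i, Complex.cos (θ j + z * τ j)) with hF
  have hFtan : ∀ z : ℂ, (∀ i, Complex.cos (θ i + z * τ i) ≠ 0) →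
      F z = (∑ i, (c i : ℂ) * Complex.tan (θ i + z * τ i)) *
        ∏ j, Complex.cos (θ j + z * τ j) := by
    intro z hz
    rw [hF, Finset.sum_mul]
    refine Finset.sum_congr rfl fun i _ => ?_
    rw [← Finset.mul_prod_erase _ _ (Finset.mem_univ i), Complex.tan]
    have := hz i
    field_simp
  have hFd : Differentiable ℂ F := by
    rw [hF]
    fun_prop
  have hfreq : ∃ᶠ z in 𝓝[≠] ((ℓ / 2 : ℝ) : ℂ), F z = 0 := by
    have h1 : ∀ᶠ s in 𝓝[≠] (ℓ / 2), s ∈ Icc 0 ℓ :=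
      nhdsWithin_le_nhds (Icc_mem_nhds (by linarith) (by linarith))
    have h2 : Tendsto (fun s : ℝ => (s : ℂ)) (𝓝[≠] (ℓ / 2)) (𝓝[≠] ((ℓ / 2 : ℝ) : ℂ)) := by
      refine tendsto_nhdsWithin_iff.2 ⟨(Complex.continuous_ofReal.tendsto _).mono_left
        nhdsWithin_le_nhds, ?_⟩
      filter_upwards [self_mem_nhdsWithin] with s hs
      exact fun h => hs (Complex.ofReal_injective h)
    refine h2.frequently (((frequently_cos_ne_zero θ hτ (ℓ / 2)).and_eventually h1).mono ?_)
    rintro s ⟨hs, hsI⟩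
    have hcs : ∀ i, Complex.cos ((θ i : ℂ) + (s : ℂ) * τ i) ≠ 0 := fun i => by
      exact_mod_cast hs i
    rw [hFtan _ hcs]
    have := h s hsI hs
    have h3 : ∑ i, (c i : ℂ) * Complex.tan ((θ i : ℂ) + (s : ℂ) * τ i) = 0 := by
      exact_mod_cast congrArg (fun x : ℝ => (x : ℂ)) this
    rw [h3, zero_mul]
  have hF0 : ∀ z, F z = 0 := fun z =>
    (hFd.differentiableOn.analyticOnNhd isOpen_univ).eqOn_zero_of_preconnected_of_frequently_eq_zero
      isPreconnected_univ (mem_univ _) hfreq (mem_univ z)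
  have hcs : ∀ i, Complex.cos ((θ i : ℂ) + Complex.I * σ * τ i) ≠ 0 := fun i =>
    cos_ne_zero_of_im_pos (by simpa using mul_pos hσ (hτ i))
  have := hF0 (Complex.I * σ)
  rw [hFtan _ hcs] at this
  exact (mul_eq_zero.1 this).resolve_right (Finset.prod_ne_zero_iff.2 fun i _ => hcs i)

/-- The formula tan w = i - 2i q/(1 + q) with q = e^{2iw}, which exhibits the decay rate 2τ. -/
theorem tan_upper_eq {θ τ σ : ℝ} (hτ : 0 < τ) (hσ : 0 < σ) :
    Complex.tan (θ + Complex.I * σ * τ) = Complex.I - 2 * Complex.I *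
      (Complex.exp (2 * Complex.I * θ) * (Real.exp (-(2 * τ * σ)) : ℂ) /
        (1 + Complex.exp (2 * Complex.I * θ) * (Real.exp (-(2 * τ * σ)) : ℂ))) := by
  set w : ℂ := θ + Complex.I * σ * τ with hw
  have hq : Complex.exp (2 * Complex.I * θ) * (Real.exp (-(2 * τ * σ)) : ℂ)
      = Complex.exp (w * Complex.I) * Complex.exp (w * Complex.I) := by
    rw [Complex.ofReal_exp, ← Complex.exp_add, ← Complex.exp_add, hw]
    congr 1
    push_cast
    linear_combination (-2 * (σ : ℂ) * τ) * Complex.I_sq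
  have hcos : Complex.cos w ≠ 0 := cos_ne_zero_of_im_pos (by simpa [hw] using mul_pos hσ hτ)
  rw [hq]
  have hE : Complex.exp (-w * Complex.I) = (Complex.exp (w * Complex.I))⁻¹ := by
    rw [neg_mul, Complex.exp_neg]
  have hE0 := Complex.exp_ne_zero (w * Complex.I)
  set E := Complex.exp (w * Complex.I)
  have hc : Complex.cos w = (1 + E * E) / (2 * E) := by
    rw [Complex.cos, hE]; field_simp; ring
  have h1 : 1 + E * E ≠ 0 := fun h => hcos (by rw [hc, h, zero_div])
  have hs : Complex.sin w = (E⁻¹ - E) * Complex.I / 2 := by rw [Complex.sin, hE]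
  rw [Complex.tan, hc, hs]
  rw [← sq] at h1 ⊢
  field_simp
  ring

/-- The relation `∑ tan (θ_j + s τ_j) = ∑ tan (θ'_j + s τ'_j)` on an interval determines the
rates. -/
theorem range_eq_of_tan_sum_eq {n n' : ℕ} {τ : Fin n → ℝ} {τ' : Fin n' → ℝ}
    (hτ : ∀ i, 0 < τ i) (hτ' : ∀ i, 0 < τ' i) (hinj : Function.Injective τ)
    (hinj' : Function.Injective τ') (θ : Fin n → ℝ) (θ' : Fin n' → ℝ)
    (h : ∀ σ : ℝ, 0 < σ → ∑ i, Complex.tan (θ i + Complex.I * σ * τ i)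
      = ∑ i, Complex.tan (θ' i + Complex.I * σ * τ' i)) : range τ = range τ' := by
  classical
  set f : ℂ → ℂ := fun q => q / (1 + q) with hf
  set p : Fin n → ℂ := fun i => Complex.exp (2 * Complex.I * θ i) with hp
  set p' : Fin n' → ℂ := fun i => Complex.exp (2 * Complex.I * θ' i) with hp'
  -- Phases indexed by the rate itself, with 0 for rates that do not occur. Injectivity of τ makes
  -- this well defined; true phases are exponentials, so P is nonzero exactly on the range of τ.
  set P : ℝ → ℂ := Function.extend τ p 0 with hP
  set P' : ℝ → ℂ := Function.extend τ' p' 0 with hP'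
  set T : Finset ℝ := Finset.univ.image τ ∪ Finset.univ.image τ' with hT
  set d : ℝ → ℝ → ℂ := fun t σ => ((Real.exp (-(2 * t * σ)) : ℝ) : ℂ) with hd
  have hTpos : ∀ t ∈ T, 0 < t := by
    intro t ht
    simp only [hT, Finset.mem_union, Finset.mem_image, Finset.mem_univ, true_and] at ht
    rcases ht with ⟨i, rfl⟩ | ⟨i, rfl⟩
    exacts [hτ i, hτ' i]
  have hdlim : ∀ t, 0 < t → Tendsto (d t) atTop (𝓝 0) := by
    intro t ht
    have : Tendsto (fun σ : ℝ => Real.exp (-(2 * t * σ))) atTop (𝓝 0) :=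
      Real.tendsto_exp_neg_atTop_nhds_zero.comp (tendsto_id.const_mul_atTop (by linarith))
    have h2 := (Complex.continuous_ofReal.tendsto 0).comp this
    rwa [Complex.ofReal_zero] at h2
  have hfd : ∀ (z : ℂ) t, 0 < t → Tendsto (fun σ => f (z * d t σ)) atTop (𝓝 0) := by
    intro z t ht
    have h1 := (hdlim t ht).const_mul z
    have h2 : Tendsto (fun σ => f (z * d t σ)) atTop (𝓝 (z * 0 / (1 + z * 0))) :=
      h1.div (h1.const_add 1) (by simp)
    simpa using h2
  have hfe : ∀ (z : ℂ) t, 0 < t →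
      Tendsto (fun σ => f (z * d t σ) * (Real.exp (2 * t * σ) : ℂ)) atTop (𝓝 z) := by
    intro z t ht
    have h1 := (hdlim t ht).const_mul z
    have h2 : Tendsto (fun σ => z / (1 + z * d t σ)) atTop (𝓝 (z / (1 + z * 0))) :=
      tendsto_const_nhds.div (h1.const_add 1) (by simp)
    simp only [mul_zero, add_zero, div_one] at h2
    refine h2.congr fun σ => ?_
    have h3 : d t σ * (Real.exp (2 * t * σ) : ℂ) = 1 := by
      rw [hd, ← Complex.ofReal_mul, ← Real.exp_add]
      simp
    rw [hf]
    simp only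
    rw [div_mul_eq_mul_div, mul_assoc, h3, mul_one]
  have hsumP : ∀ σ, ∑ i, f (p i * d (τ i) σ) = ∑ t ∈ T, f (P t * d t σ) := by
    intro σ
    rw [← Finset.sum_subset (Finset.subset_union_left (s₂ := Finset.univ.image τ'))]
    · rw [Finset.sum_image fun a _ b _ hab => hinj hab]
      exact Finset.sum_congr rfl fun i _ => by rw [hP, hinj.extend_apply]
    · intro t _ ht
      rw [hP, Function.extend_apply' _ _ _ (by simpa using ht)]
      simp [hf]
  have hsumP' : ∀ σ, ∑ i, f (p' i * d (τ' i) σ) = ∑ t ∈ T, f (P' t * d t σ) := by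
    intro σ
    rw [← Finset.sum_subset (Finset.subset_union_right (s₁ := Finset.univ.image τ))]
    · rw [Finset.sum_image fun a _ b _ hab => hinj' hab]
      exact Finset.sum_congr rfl fun i _ => by rw [hP', hinj'.extend_apply]
    · intro t _ ht
      rw [hP', Function.extend_apply' _ _ _ (by simpa using ht)]
      simp [hf]
  have hrel : ∀ σ, 0 < σ → (n : ℂ) * Complex.I - 2 * Complex.I * ∑ t ∈ T, f (P t * d t σ)
      = (n' : ℂ) * Complex.I - 2 * Complex.I * ∑ t ∈ T, f (P' t * d t σ) := by
    intro σ hσ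
    have h1 := h σ hσ
    rw [Finset.sum_congr rfl fun i _ => tan_upper_eq (hτ i) hσ,
      Finset.sum_congr rfl fun i _ => tan_upper_eq (hτ' i) hσ, Finset.sum_sub_distrib,
      Finset.sum_sub_distrib, ← Finset.mul_sum, ← Finset.mul_sum] at h1
    rw [← hsumP, ← hsumP']
    simp only [Finset.sum_const, Finset.card_univ, Fintype.card_fin, nsmul_eq_mul] at h1
    exact h1
  -- As σ → ∞ each tangent tends to i, so the constant terms agree and drop out of the relation.
  have hnn : (n : ℂ) * Complex.I = (n' : ℂ) * Complex.I := by
    have h1 := ((tendsto_finsetSum T fun t ht => hfd (P t) t (hTpos t ht)).const_mul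
      (2 * Complex.I)).const_sub ((n : ℂ) * Complex.I)
    have h2 := ((tendsto_finsetSum T fun t ht => hfd (P' t) t (hTpos t ht)).const_mul
      (2 * Complex.I)).const_sub ((n' : ℂ) * Complex.I)
    simp only [Finset.sum_const_zero, mul_zero, sub_zero] at h1 h2
    refine tendsto_nhds_unique h1 (h2.congr' ?_)
    filter_upwards [eventually_gt_atTop 0] with σ hσ using (hrel σ hσ).symm
  have hkey := leading_coeff_eq_zero T (fun t σ => f (P t * d t σ) - f (P' t * d t σ))
    (fun t => P t - P' t)
    (fun t ht => ((hfe (P t) t (hTpos t ht)).sub (hfe (P' t) t (hTpos t ht))).congr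
      fun σ => by ring)
    (fun t _ hc σ => by simp only [sub_eq_zero.1 hc, sub_self])
    (fun σ hσ => by
      rw [Finset.sum_sub_distrib]
      have h1 := hrel σ hσ
      rw [hnn] at h1
      have h2 : (2 * Complex.I) ≠ 0 := by simp
      exact sub_eq_zero.2 (mul_left_cancel₀ h2 (sub_right_injective h1)))
  have hmem : ∀ t, t ∈ range τ ↔ P t ≠ 0 := by
    intro t
    constructor
    · rintro ⟨i, rfl⟩
      rw [hP, hinj.extend_apply]
      exact Complex.exp_ne_zero _
    · intro ht
      by_contra hn
      exact ht (by rw [hP, Function.extend_apply' _ _ _ (by simpa using hn)]; rfl)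
  have hmem' : ∀ t, t ∈ range τ' ↔ P' t ≠ 0 := by
    intro t
    constructor
    · rintro ⟨i, rfl⟩
      rw [hP', hinj'.extend_apply]
      exact Complex.exp_ne_zero _
    · intro ht
      by_contra hn
      exact ht (by rw [hP', Function.extend_apply' _ _ _ (by simpa using hn)]; rfl)
  ext t
  by_cases ht : t ∈ T
  · rw [hmem, hmem', sub_eq_zero.1 (hkey t ht)]
  · simp only [hT, Finset.mem_union, Finset.mem_image, Finset.mem_univ, true_and, not_or] at ht
    exact iff_of_false ht.1 ht.2

/-! ### Consequences for the reflection coefficient -/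

namespace StarNetwork

variable {m n : ℕ} {N : StarNetwork m n}

theorem Assumptions.asymptotics_of_eventually [NeZero m] (hN : N.Assumptions) {R : ℝ → ℂ}
    (hR : ∀ᶠ k : ℝ in atTop, N.IsReflectionCoeff k (R k)) {ε : ℝ} (hε : 0 < ε) :
    ∃ K : ℝ, 0 < K ∧ ∀ k : ℝ, K ≤ k → (∀ j, K ≤ k * Real.cos (k * N.tau j) ^ 2) →
      |(m : ℝ) - 2 * (1 / (1 + R k)).re| < ε ∧
      |∑ j, Real.tan (k * N.tau j) - (-2 * (1 / (1 + R k)).im)| < ε := by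
  obtain ⟨C, K₀, hC, hK₀, H⟩ := hN.reflectionCoeff_asymptotics
  obtain ⟨K₁, hK₁⟩ := eventually_atTop.1 hR
  -- The real and imaginary parts are doubled in the formulas, so C/K < ε/2 is needed.
  set K := max (max K₀ K₁) (2 * C / ε + 1) with hK
  have h1 : K₀ ≤ K := (le_max_left _ _).trans (le_max_left _ _)
  have h2 : K₁ ≤ K := (le_max_right _ _).trans (le_max_left _ _)
  have h3 : 2 * C / ε + 1 ≤ K := le_max_right _ _
  have hK0 : 0 < K := by linarith
  refine ⟨K, hK0, fun k hk hcos => ?_⟩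
  have hmain := H K h1 k hk hcos (R k) (hK₁ k (h2.trans hk))
  set T := ∑ j, Real.tan (k * N.tau j)
  set w := 1 / (1 + R k)
  have hsmall : 2 * (C / K) < ε := by
    have : 2 * C / ε < K := by linarith
    rw [div_lt_iff₀ hε] at this
    rw [← mul_div_assoc, div_lt_iff₀ hK0]
    linarith
  have hre : (w - ((m : ℂ) - Complex.I * (T : ℂ)) / 2).re = w.re - m / 2 := by
    simp
  have him : (w - ((m : ℂ) - Complex.I * (T : ℂ)) / 2).im = w.im + T / 2 := by
    simp; ring
  have h4 := (Complex.abs_re_le_norm _).trans hmain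
  have h5 := (Complex.abs_im_le_norm _).trans hmain
  rw [hre] at h4
  rw [him] at h5
  rw [abs_le] at h4 h5
  constructor <;> rw [abs_lt] <;> constructor <;> linarith

theorem Assumptions.asymptotics_away_from_poles [NeZero m] (hN : N.Assumptions) {R : ℝ → ℂ}
    (hR : ∀ᶠ k : ℝ in atTop, N.IsReflectionCoeff k (R k)) {ε δ : ℝ} (hε : 0 < ε) (hδ : 0 < δ) :
    ∃ K : ℝ, 0 < K ∧ ∀ k : ℝ, K ≤ k → (∀ j, δ ≤ |Real.cos (k * N.tau j)|) →
      |(m : ℝ) - 2 * (1 / (1 + R k)).re| < ε ∧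
      |∑ j, Real.tan (k * N.tau j) - (-2 * (1 / (1 + R k)).im)| < ε := by
  obtain ⟨K, hK, H⟩ := hN.asymptotics_of_eventually hR hε
  refine ⟨max K (K / δ ^ 2), lt_max_of_lt_left hK, fun k hk hcos =>
    H k ((le_max_left _ _).trans hk) fun j => ?_⟩
  have h1 : K / δ ^ 2 ≤ k := (le_max_right _ _).trans hk
  rw [div_le_iff₀ (by positivity)] at h1
  have h2 : δ ^ 2 ≤ Real.cos (k * N.tau j) ^ 2 := by
    rw [← sq_abs (Real.cos _)]
    have := hcos j
    gcongr
  have hk0 : 0 ≤ k := hK.le.trans ((le_max_left _ _).trans hk)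
  exact h1.trans (by gcongr)

theorem Assumptions.exists_reflectionCoeff_unique [NeZero m] (hN : N.Assumptions) :
    ∀ᶠ k : ℝ in atTop, ∃! r : ℂ, N.IsReflectionCoeff k r := by
  obtain ⟨M, hM, hb⟩ := hN.exists_isWaveBasis
  filter_upwards [eventually_ge_atTop M] with k hk
  obtain ⟨u, u1, v, v1, hu⟩ := hb k hk
  have hk0 : 0 < k := by linarith
  obtain ⟨r, hr⟩ := hN.exists_reflectionCoeff hk0 hu
  exact ⟨r, hr, fun r' hr' => hN.reflectionCoeff_unique hk0 hu hr' hr⟩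

theorem Assumptions.im_bounded_away_from_poles [NeZero m] (hN : N.Assumptions) {R : ℝ → ℂ}
    (hR : ∀ᶠ k : ℝ in atTop, N.IsReflectionCoeff k (R k)) {δ : ℝ} (hδ : 0 < δ) :
    ∃ K B : ℝ, ∀ k : ℝ, K ≤ k →
      (∀ j, δ ≤ |Real.cos (k * N.tau j)|) → |(1 / (1 + R k)).im| ≤ B := by
  obtain ⟨K, -, H⟩ := hN.asymptotics_away_from_poles hR one_pos hδ
  refine ⟨K, n * (1 / δ) + 1, fun k hk hcos => ?_⟩
  have h1 := (H k hk hcos).2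
  have h2 : |∑ j, Real.tan (k * N.tau j)| ≤ n * (1 / δ) := by
    refine (Finset.abs_sum_le_sum_abs _ _).trans ((Finset.sum_le_sum (g := fun _ => 1 / δ)
      fun j _ => ?_).trans (le_of_eq (by simp)))
    rw [Real.tan_eq_sin_div_cos, abs_div]
    exact div_le_div₀ zero_le_one (Real.abs_sin_le_one _) hδ (hcos j)
  have h3 : 0 ≤ n * (1 / δ) := by positivity
  rw [abs_lt] at h1
  rw [abs_le] at h2 ⊢
  constructor <;> linarith

theorem Assumptions.im_large_near_poles [NeZero m] (hN : N.Assumptions) {R : ℝ → ℂ}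
    (hR : ∀ᶠ k : ℝ in atTop, N.IsReflectionCoeff k (R k)) {η : ℝ} (B : ℝ) (hη : 0 < η) :
    ∃ K : ℝ, ∀ p : ℝ, K ≤ p → (∃ j, Real.cos (p * N.tau j) = 0) →
      ∃ k : ℝ, |k - p| < η ∧ B < |(1 / (1 + R k)).im| := by
  have hY : IsClosed (⋃ j, {θ : Fin n → ℝ | Real.cos (θ j) = 0}) :=
    isClosed_iUnion_of_finite fun j =>
      isClosed_eq (Real.continuous_cos.comp (continuous_apply j)) continuous_const
  -- The tangent sum is within 1 of -2 Im(1/(1+R)), so a sum above 2|B| + 1 suffices. `hY` consists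
  -- of the phase vectors sitting at a pole.
  obtain ⟨δ, hδ, hshift⟩ := exists_uniform_frequency_shift N.tau (fun _ => 1) hY (Ioo (-η) η)
    (2 * |B| + 1) fun θ hθ => by
      obtain ⟨j, hj⟩ := mem_iUnion.1 hθ
      exact exists_large_tan_sum hN.tau_pos hj hη _
  obtain ⟨K, -, H⟩ := hN.asymptotics_away_from_poles hR one_pos hδ
  refine ⟨K + η, fun p hp ⟨j, hj⟩ => ?_⟩
  obtain ⟨s, hs, hcos, hlarge⟩ := hshift p fun M => mem_iUnion.2 ⟨j, by
    show Real.cos (p * N.tau j - M j * Real.pi) = 0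
    rw [Real.cos_sub_int_mul_pi, hj, mul_zero]⟩
  refine ⟨p + s, by rw [add_sub_cancel_left]; exact abs_lt.2 hs, ?_⟩
  have h1 := (H (p + s) (by linarith [hs.1]) hcos).2
  simp only [one_mul] at hlarge
  have h2 := abs_sub_abs_le_abs_sub (∑ j, Real.tan ((p + s) * N.tau j))
    (-2 * (1 / (1 + R (p + s))).im)
  rw [abs_mul, abs_neg, abs_two] at h2
  linarith [le_abs_self B]

variable {m' n' : ℕ} {N' : StarNetwork m' n'}

theorem Assumptions.infinite_branches_determined [NeZero m] [NeZero m'] (hN : N.Assumptions)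
    (hN' : N'.Assumptions) {R R' : ℝ → ℂ} (hR : ∀ᶠ k : ℝ in atTop, N.IsReflectionCoeff k (R k))
    (hR' : ∀ᶠ k : ℝ in atTop, N'.IsReflectionCoeff k (R' k)) {ℓ : ℝ} (hℓ : 0 < ℓ) :
    ∃ kstar : ℝ, ∀ a : ℝ, kstar ≤ a → (∀ k ∈ Icc a (a + ℓ), R k = R' k) → m = m' := by
  -- Zero coefficients and the level -1 make the second condition void; only a frequency uniformly
  -- away from the poles of both networks is wanted. There m and m' are within 1/2 of the same
  -- number.
  obtain ⟨δ, hδ, hshift⟩ := exists_uniform_frequency_shift (Sum.elim N.tau N'.tau)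
    (fun _ => 0) isClosed_univ (Icc 0 ℓ) (-1) fun θ _ => by
      obtain ⟨s, hs, h⟩ := exists_cos_ne_zero θ
        (τ := Sum.elim N.tau N'.tau) (by rintro (i | i); exacts [hN.tau_pos i, hN'.tau_pos i]) hℓ
      exact ⟨s, hs, h, by simp⟩
  obtain ⟨K, -, H⟩ := hN.asymptotics_away_from_poles hR one_half_pos hδ
  obtain ⟨K', -, H'⟩ := hN'.asymptotics_away_from_poles hR' one_half_pos hδ
  refine ⟨max K K', fun a ha hRR => ?_⟩
  obtain ⟨s, hs, hcos, -⟩ := hshift a fun _ => mem_univ _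
  have h1 := (H (a + s) (by linarith [hs.1, le_max_left K K']) fun j => hcos (Sum.inl j)).1
  have h2 := (H' (a + s) (by linarith [hs.1, le_max_right K K']) fun j => hcos (Sum.inr j)).1
  rw [← hRR (a + s) ⟨by linarith [hs.1], by linarith [hs.2]⟩] at h2
  rw [abs_lt] at h1 h2
  have h3 : (m : ℝ) < m' + 1 := by linarith
  have h4 : (m' : ℝ) < m + 1 := by linarith
  have h5 : m < m' + 1 := by exact_mod_cast h3
  have h6 : m' < m + 1 := by exact_mod_cast h4
  omega

theorem Assumptions.travel_times_determined [NeZero m] [NeZero m'] (hN : N.Assumptions)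
    (hN' : N'.Assumptions) {R R' : ℝ → ℂ} (hR : ∀ᶠ k : ℝ in atTop, N.IsReflectionCoeff k (R k))
    (hR' : ∀ᶠ k : ℝ in atTop, N'.IsReflectionCoeff k (R' k))
    (hinj : Function.Injective N.tau) (hinj' : Function.Injective N'.tau) {ℓ : ℝ} (hℓ : 0 < ℓ) :
    ∃ kstar : ℝ, ∀ a : ℝ, kstar ≤ a →
      (∀ k ∈ Icc a (a + ℓ), (1 / (1 + R k)).im = (1 / (1 + R' k)).im) →
        ∃ σ : Fin n ≃ Fin n', ∀ j, N'.tau (σ j) = N.tau j := by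
  -- If the ranges agree, the bijection exists whatever the data. Otherwise no phases make the two
  -- tangent sums agree on [0, ℓ], and compactness gives a gap δ somewhere in every window, against
  -- two errors below δ/2.
  by_cases hrange : range N.tau = range N'.tau
  · refine ⟨0, fun _ _ _ => ⟨(Equiv.ofInjective _ hinj).trans
      ((Equiv.setCongr hrange).trans (Equiv.ofInjective _ hinj').symm), fun j => ?_⟩⟩
    simp [Equiv.apply_ofInjective_symm hinj']
  have hpos : ∀ i, 0 < Sum.elim N.tau N'.tau i := by
    rintro (i | i)
    exacts [hN.tau_pos i, hN'.tau_pos i]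
  obtain ⟨δ, hδ, hshift⟩ := exists_uniform_frequency_shift (Sum.elim N.tau N'.tau)
    (Sum.elim (fun _ => 1) fun _ => -1) isClosed_univ (Icc 0 ℓ) 0 fun θ _ => by
      by_contra hcon
      push Not at hcon
      refine hrange (range_eq_of_tan_sum_eq hN.tau_pos hN'.tau_pos hinj hinj'
        (fun i => θ (Sum.inl i)) (fun i => θ (Sum.inr i)) fun σ hσ => ?_)
      have := tan_sum_eq_zero_upper hpos θ (Sum.elim (fun _ => 1) fun _ => -1) hℓ
        (fun s hs hcos => abs_nonpos_iff.1 (hcon s hs hcos)) hσ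
      rw [Fintype.sum_sum_type] at this
      simp only [Sum.elim_inl, Sum.elim_inr, Complex.ofReal_one, Complex.ofReal_neg, one_mul,
        neg_mul, Finset.sum_neg_distrib] at this
      linear_combination this
  obtain ⟨K, -, H⟩ := hN.asymptotics_away_from_poles hR (half_pos hδ) hδ
  obtain ⟨K', -, H'⟩ := hN'.asymptotics_away_from_poles hR' (half_pos hδ) hδ
  refine ⟨max K K', fun a ha hRR => ?_⟩
  obtain ⟨s, hs, hcos, hlarge⟩ := hshift a fun _ => mem_univ _
  have h1 := (H (a + s) (by linarith [hs.1, le_max_left K K']) fun j => hcos (Sum.inl j)).2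
  have h2 := (H' (a + s) (by linarith [hs.1, le_max_right K K']) fun j => hcos (Sum.inr j)).2
  rw [← hRR (a + s) ⟨by linarith [hs.1], by linarith [hs.2]⟩] at h2
  rw [Fintype.sum_sum_type] at hlarge
  simp only [Sum.elim_inl, Sum.elim_inr, one_mul, neg_mul, Finset.sum_neg_distrib, zero_add]
    at hlarge
  rw [abs_lt] at h1 h2
  rcases le_abs.1 hlarge with h | h <;> linarith

end StarNetwork

end

theorem mainTheorem2 {m n : ℕ} [NeZero m] (N : StarNetwork m n) (hN : N.Assumptions) :
    -- the reflection coefficient is well defined at high frequencies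
    (∀ᶠ k : ℝ in atTop, ∃! r : ℂ, N.IsReflectionCoeff k r) ∧
    ∀ R : ℝ → ℂ, (∀ᶠ k : ℝ in atTop, N.IsReflectionCoeff k (R k)) →
      -- the two asymptotic formulas, as `k → ∞` and `k cos² (k τ_j) → ∞` for every `j`
      (∀ ε : ℝ, 0 < ε → ∃ K : ℝ, ∀ k : ℝ, K ≤ k →
        (∀ j, K ≤ k * Real.cos (k * N.tau j) ^ 2) →
          |(m : ℝ) - 2 * (1 / (1 + R k)).re| < ε ∧
          |∑ j, Real.tan (k * N.tau j) - (-2 * (1 / (1 + R k)).im)| < ε) ∧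
      -- the poles of `Im (1 / (1 + R))`: bounded off the poles of the `tan (k τ_j)`, ...
      (∀ δ : ℝ, 0 < δ → ∃ K B : ℝ, ∀ k : ℝ, K ≤ k →
        (∀ j, δ ≤ |Real.cos (k * N.tau j)|) → |(1 / (1 + R k)).im| ≤ B) ∧
      -- ... and arbitrarily large arbitrarily close to each of them
      (∀ η B : ℝ, 0 < η → ∃ K : ℝ, ∀ p : ℝ, K ≤ p →
        (∃ j, Real.cos (p * N.tau j) = 0) →
          ∃ k : ℝ, |k - p| < η ∧ B < |(1 / (1 + R k)).im|) ∧
      -- identification from any interval of high frequencies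
      ∀ (m' n' : ℕ) [NeZero m'] (N' : StarNetwork m' n'), N'.Assumptions →
        ∀ R' : ℝ → ℂ, (∀ᶠ k : ℝ in atTop, N'.IsReflectionCoeff k (R' k)) →
          -- of the number of infinite branches
          (∀ ℓ : ℝ, 0 < ℓ → ∃ kstar : ℝ, ∀ a : ℝ, kstar ≤ a →
            (∀ k ∈ Icc a (a + ℓ), R k = R' k) → m = m') ∧
          -- of the travelling times of the finite branches, when these are distinct
          (Function.Injective N.tau → Function.Injective N'.tau →
            ∀ ℓ : ℝ, 0 < ℓ → ∃ kstar : ℝ, ∀ a : ℝ, kstar ≤ a →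
              (∀ k ∈ Icc a (a + ℓ), (1 / (1 + R k)).im = (1 / (1 + R' k)).im) →
                ∃ σ : Fin n ≃ Fin n', ∀ j, N'.tau (σ j) = N.tau j) := by
  refine ⟨hN.exists_reflectionCoeff_unique, fun R hR => ⟨fun ε hε => ?_,
    fun δ hδ => hN.im_bounded_away_from_poles hR hδ,
    fun η B hη => hN.im_large_near_poles hR B hη, ?_⟩⟩
  · obtain ⟨K, -, H⟩ := hN.asymptotics_of_eventually hR hε
    exact ⟨K, H⟩
  · intro m' n' _ N' hN' R' hR'
    exact ⟨fun ℓ hℓ => hN.infinite_branches_determined hN' hR hR' hℓ,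
      fun hinj hinj' ℓ hℓ => hN.travel_times_determined hN' hR hR' hinj hinj' hℓ⟩
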